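/- **Setting.** Let $n\in\{1,2,3\}$ and let $\mathcal D\subset\mathbb R^n$ be decomposed by a finite conforming mesh of curved cells $\kappa=T_\kappa(\hat\kappa)$, where $\hat\kappa$ is the unit simplex or the unit cube and $T_\kappa$ is a $C^2$ map that is injective with positive Jacobian determinant on $\hat\kappa$. Let $\mathcal F$ be the set of interior and boundary faces, each with a fixed unit normal $\mathbf n$: on an interior face between $\kappa$ and $\kappa'$ it points from $\kappa$ to $\kappa'$, on a boundary face it points outward. Put $[\![u]\!]=u_\kappa-u_{\kappa'}$ and $\{u\}=\tfrac12(u_\kappa+u_{\kappa'})$ on interior faces, and $[\![u]\!]=u_\kappa$, $\{u\}=\theta u_\kappa$ on boundary faces, where $\theta\in\mathbb R$ is fixed ($\theta=1$ is the usual convention; $\theta=\frac12$ gives exactly the upwind flux on the boundary). Let $\mathcal U$ be the discontinuous finite element space of functions $u$ with $u|_\kappa\circ T_\kappa$ a polynomial of degree at most $r$ on $\hat\kappa$ (in the total degree or in each variable, the choice being fixed for each of the two reference cells), with a fixed basis. Let $(\Omega_d,w_d)$ be finitely many directions $\Omega_d\in\mathbb S^2$ and weights $w_d>0$ with $\sum_d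 w_d=4\pi$, $\sum_d w_d\Omega_d=0$, $\sum_d w_d\Omega_d\Omega_d^T=\frac{4\pi}3 I$; for $n<3$ only the first $n$ components of $\Omega_d$ enter below. Let $\sigma_t>0$ and $\sigma_a\ge0$ (a.e.) be integrable on $\mathcal D$. Define matrices in the basis of $\mathcal U$ by $$\mathbf v^TM_{t}\mathbf u=\sum_\kappa\int_\kappa\sigma_{t}uv\,dx,\qquad \mathbf v^TM_{a}\mathbf u=\sum_\kappa\int_\kappa\sigma_{a}uv\,dx,\qquad \mathbf v^TG_j\mathbf u=\sum_\kappa\int_\kappa(\partial_ju)v\,dx,$$ $$\mathbf v^TF^{(d)}\mathbf u=-\sum_{\Gamma\in\mathcal F}\int_\Gamma\Omega_d\cdot\mathbf n\,[\![u]\!]\{v\}\,dS+\tfrac12\sum_{\Gamma\in\mathcal F}\int_\Gamma|\Omega_d\cdot\mathbf n|\,[\![u]\!][\![v]\!]\,dS,$$ $$\mathbf v^T\tilde F^{(d)}\mathbf u=\sum_{\Gamma\in\mathcal F}\int_\Gamma\Omega_d\cdot\mathbf n\,\{u\}[\![v]\!]\,dS+\tfrac12\sum_{\Gamma\in\mathcal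 F}\int_\Gamma|\Omega_d\cdot\mathbf n|\,[\![u]\!][\![v]\!]\,dS,$$ and set, with $\Omega_d\cdot\mathbf G=\sum_j(\Omega_d)_jG_j$, $$S_\varepsilon=\sum_dw_d\bigl(I+\varepsilon M_t^{-1}(\Omega_d\cdot\mathbf G+F^{(d)})\bigr)^{-1}\tfrac1{4\pi}\bigl(I-\varepsilon^2M_t^{-1}M_a\bigr),$$ $$F_0=\tfrac1{4\pi}\sum_dw_dF^{(d)},\quad F_{1,j}=\tfrac1{4\pi}\sum_dw_d(\Omega_d)_jF^{(d)},\quad \tilde F_{1,j}=\tfrac1{4\pi}\sum_dw_d(\Omega_d)_j\tilde F^{(d)},$$ $$D_0=\tfrac13\sum_jG_j^TM_t^{-1}G_j-\sum_j\tilde F_{1,j}M_t^{-1}G_j+\sum_jG_j^TM_t^{-1}F_{1,j}+M_a,\qquad D_\varepsilon=\tfrac1\varepsilon F_0+D_0 .$$ **Theorem.** Assume that $\alpha(x)=\frac1{4\pi}\sum_dw_d|\Omega_d\cdot\mathbf n(x)|$ is bounded below by a positive constant on all interior and boundary faces. Assume also that $\sigma_a>0$ a.e. on $\mathcal D$, or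 that all the maps $T_\kappa$ are affine on $\hat\kappa$, or, if neither holds, that $D_\varepsilon$ is nonsingular for at least one $\varepsilon>0$. Then $M_t$ is nonsingular, and for all sufficiently small $\varepsilon>0$ the matrices $I+\varepsilon M_t^{-1}(\Omega_d\cdot\mathbf G+F^{(d)})$ and $D_\varepsilon$ are nonsingular, and $$(\varepsilon^2D_\varepsilon)^{-1}M_t(I-S_\varepsilon)=I+\mathcal O(\varepsilon)\qquad(\varepsilon\to0^+),$$ that is, each entry of the difference from $I$ is at most $C\varepsilon$ in absolute value, with $C$ independent of $\varepsilon$. -/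

import Mathlib

open scoped Matrix
open MeasureTheory

noncomputable section

namespace DGTransport

/-! ### Reference cells -/

/-- The reference cells: the unit simplex and the unit cube. -/
inductive RefCell
  | simplex
  | cube

/-- The closed unit simplex, resp. the closed unit cube, of `ℝⁿ`. -/
def RefCell.carrier (c : RefCell) (n : ℕ) : Set (Fin n → ℝ) :=
  match c with
  | .simplex => {x | (∀ i, 0 ≤ x i) ∧ ∑ i, x i ≤ 1}
  | .cube => Set.Icc 0 1

/-- The faces of a reference cell in dimension `m + 1`. Simplex: `some i` is the face `xᵢ = 0`, and
`none` is the face `∑ xᵢ = 1`. Cube: `(i, false)` is the face `xᵢ = 0`, and `(i, true)` the face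
`xᵢ = 1`. -/
def RefCell.Face (m : ℕ) : RefCell → Type
  | .simplex => Option (Fin (m + 1))
  | .cube => Fin (m + 1) × Bool

/-- The affine parametrization of a reference face over the `m`-dimensional unit simplex (for the
simplex) or unit cube (for the cube). -/
def RefCell.faceParam {m : ℕ} : (c : RefCell) → c.Face m → (Fin m → ℝ) → (Fin (m + 1) → ℝ)
  | .simplex, some i, s => i.insertNth (0 : ℝ) s
  | .simplex, none, s => Fin.cons (1 - ∑ i, s i) s
  | .cube, (i, false), s => i.insertNth (0 : ℝ) s
  | .cube, (i, true), s => i.insertNth (1 : ℝ) s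

/-- The outward normal vector of a reference face, with length equal to the (constant) area
density of the parametrization `faceParam`. -/
def RefCell.faceNormal {m : ℕ} : (c : RefCell) → c.Face m → (Fin (m + 1) → ℝ)
  | .simplex, some i => -Pi.single i 1
  | .simplex, none => 1
  | .cube, (i, false) => -Pi.single i 1
  | .cube, (i, true) => Pi.single i 1

/-- Polynomials of degree at most `r` in the total degree, or in each variable separately. -/
inductive DegreeKind
  | total
  | separate

/-- The space of polynomials of degree at most `r` on a reference cell. -/
def DegreeKind.space (t : DegreeKind) (n r : ℕ) : Submodule ℝ (MvPolynomial (Fin n) ℝ) :=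
  match t with
  | .total => MvPolynomial.restrictTotalDegree (Fin n) ℝ r
  | .separate => MvPolynomial.restrictDegree (Fin n) ℝ r

/-! ### Curved meshes -/

/-- The Jacobian matrix of a map `ℝⁿ → ℝⁿ`. -/
def jacobian {n : ℕ} (T : (Fin n → ℝ) → (Fin n → ℝ)) (x : Fin n → ℝ) :
    Matrix (Fin n) (Fin n) ℝ :=
  LinearMap.toMatrix' (fderiv ℝ T x).toLinearMap

/-- The physical parametrization `γ` of the face `f` of the cell with reference cell `c` and
reference-to-physical map `T`. -/
def curvedFace {m : ℕ} (T : (Fin (m + 1) → ℝ) → (Fin (m + 1) → ℝ)) (c : RefCell) (f : c.Face m)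
    (s : Fin m → ℝ) : Fin (m + 1) → ℝ :=
  T (c.faceParam f s)

/-- The outward normal vector `n · (dS / ds)` at the point `γ(s)`: Nanson's formula
`n dS = cof(DT) n̂ dŜ`, for an orientation preserving `T`. -/
def areaVector {m : ℕ} (T : (Fin (m + 1) → ℝ) → (Fin (m + 1) → ℝ)) (c : RefCell) (f : c.Face m)
    (s : Fin m → ℝ) : Fin (m + 1) → ℝ :=
  (jacobian T (c.faceParam f s)).adjugateᵀ *ᵥ c.faceNormal f

/-- The surface area density `dS / ds`. -/
def areaDensity {m : ℕ} (T : (Fin (m + 1) → ℝ) → (Fin (m + 1) → ℝ)) (c : RefCell) (f : c.Face m)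
    (s : Fin m → ℝ) : ℝ :=
  √(areaVector T c f s ⬝ᵥ areaVector T c f s)

/-- The outward unit normal at the point `γ(s)`. -/
def unitNormal {m : ℕ} (T : (Fin (m + 1) → ℝ) → (Fin (m + 1) → ℝ)) (c : RefCell) (f : c.Face m)
    (s : Fin m → ℝ) : Fin (m + 1) → ℝ :=
  (areaDensity T c f s)⁻¹ • areaVector T c f s

/-- A conforming mesh of curved cells in `ℝ^(m+1)`, with cells `K`, interior faces `I` and boundary
faces `B`. Each cell is the image of its reference cell under a `C²` map that is injective with
positive Jacobian determinant there. -/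
structure CurvedMesh (m : ℕ) (K I B : Type) where
  shape : K → RefCell
  map : K → (Fin (m + 1) → ℝ) → (Fin (m + 1) → ℝ)
  smooth : ∀ k, ContDiff ℝ 2 (map k)
  inj : ∀ k, Set.InjOn (map k) ((shape k).carrier (m + 1))
  det_pos : ∀ k, ∀ x ∈ (shape k).carrier (m + 1), 0 < (jacobian (map k) x).det
  /-- Different cells have disjoint interiors. -/
  disjoint : ∀ k l, k ≠ l → Disjoint (interior (map k '' (shape k).carrier (m + 1)))
    (interior (map l '' (shape l).carrier (m + 1)))
  /-- The two sides of an interior face: a face of the first cell and a face of the second one. The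
  unit normal of the face is chosen to point from the first cell to the second. -/
  left : I → (k : K) × (shape k).Face m
  right : I → (k : K) × (shape k).Face m
  /-- The cell face that a boundary face is. -/
  bdry : B → (k : K) × (shape k).Face m
  /-- Each face of each cell is exactly one side of an interior face or one boundary face. -/
  faces_bijective : Function.Bijective (Sum.elim (Sum.elim left right) bdry)
  /-- The two sides of an interior face are the same surface, seen from opposite sides. -/
  glue : ∀ i, ∃ π : (Fin m → ℝ) → (Fin m → ℝ),
    Set.BijOn π ((shape (left i).1).carrier m) ((shape (right i).1).carrier m) ∧
    DifferentiableOn ℝ π ((shape (left i).1).carrier m) ∧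
    ∀ s ∈ (shape (left i).1).carrier m,
      curvedFace (map (right i).1) _ (right i).2 (π s)
        = curvedFace (map (left i).1) _ (left i).2 s ∧
      unitNormal (map (right i).1) _ (right i).2 (π s)
        = -unitNormal (map (left i).1) _ (left i).2 s
  /-- Boundary faces lie on the boundary of the domain. -/
  bdry_subset : ∀ f, curvedFace (map (bdry f).1) _ (bdry f).2 '' (shape (bdry f).1).carrier m ⊆
    frontier (⋃ k, map k '' (shape k).carrier (m + 1))

variable {m : ℕ} {K I B : Type}

namespace CurvedMesh

/-- The (closed) physical cell. -/
def cell (M : CurvedMesh m K I B) (k : K) : Set (Fin (m + 1) → ℝ) :=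
  M.map k '' (M.shape k).carrier (m + 1)

/-- The (closed) domain. -/
def domain (M : CurvedMesh m K I B) : Set (Fin (m + 1) → ℝ) := ⋃ k, M.cell k

/-- All reference-to-physical maps are affine. -/
def IsAffine (M : CurvedMesh m K I B) : Prop :=
  ∀ k, ∃ A : (Fin (m + 1) → ℝ) →ᵃ[ℝ] (Fin (m + 1) → ℝ),
    Set.EqOn (M.map k) A ((M.shape k).carrier (m + 1))

/-- The cell face through which a mesh face is parametrized; the normal of the mesh face is the
outward normal of that cell. -/
def side (M : CurvedMesh m K I B) : I ⊕ B → (k : K) × (M.shape k).Face m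
  | .inl i => M.left i
  | .inr f => M.bdry f

/-- The parameter domain of a mesh face. -/
def faceDom (M : CurvedMesh m K I B) (Γ : I ⊕ B) : Set (Fin m → ℝ) :=
  (M.shape (M.side Γ).1).carrier m

/-- The parametrization of a mesh face. -/
def point (M : CurvedMesh m K I B) (Γ : I ⊕ B) (s : Fin m → ℝ) : Fin (m + 1) → ℝ :=
  curvedFace (M.map (M.side Γ).1) _ (M.side Γ).2 s

/-- The unit normal `n` of a mesh face at the point with parameter `s`. -/
def normal (M : CurvedMesh m K I B) (Γ : I ⊕ B) (s : Fin m → ℝ) : Fin (m + 1) → ℝ :=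
  unitNormal (M.map (M.side Γ).1) _ (M.side Γ).2 s

/-- The surface integral `∫_Γ g dS`, for `g` given as a function of the parameter. -/
def faceIntegral (M : CurvedMesh m K I B) (Γ : I ⊕ B) (g : (Fin m → ℝ) → ℝ) : ℝ :=
  ∫ s in M.faceDom Γ, g s * areaDensity (M.map (M.side Γ).1) _ (M.side Γ).2 s

/-- The discontinuous finite element space: one polynomial of degree at most `r` on the reference
cell of each cell. -/
abbrev DGSpace (M : CurvedMesh m K I B) (t : RefCell → DegreeKind) (r : ℕ) : Type :=
  (k : K) → (t (M.shape k)).space (m + 1) r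

variable {t : RefCell → DegreeKind} {r : ℕ}

/-- The value at the physical point `x` of the cell `k` of the function `u`:
`u(x) = û(x̂)` where `x = T_k(x̂)`. -/
def val (M : CurvedMesh m K I B) (u : M.DGSpace t r) (k : K) (x : Fin (m + 1) → ℝ) : ℝ :=
  MvPolynomial.eval (Function.invFunOn (M.map k) ((M.shape k).carrier (m + 1)) x)
    (u k : MvPolynomial (Fin (m + 1)) ℝ)

/-- The jump `⟦u⟧` across a face. -/
def jump (M : CurvedMesh m K I B) (u : M.DGSpace t r) : I ⊕ B → (Fin m → ℝ) → ℝ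
  | .inl i, s => M.val u (M.left i).1 (M.point (.inl i) s)
      - M.val u (M.right i).1 (M.point (.inl i) s)
  | .inr f, s => M.val u (M.bdry f).1 (M.point (.inr f) s)

/-- The average `{u}` on a face; on a boundary face it is `θ u`. -/
def avg (M : CurvedMesh m K I B) (θ : ℝ) (u : M.DGSpace t r) : I ⊕ B → (Fin m → ℝ) → ℝ
  | .inl i, s => (M.val u (M.left i).1 (M.point (.inl i) s)
      + M.val u (M.right i).1 (M.point (.inl i) s)) / 2
  | .inr f, s => θ * M.val u (M.bdry f).1 (M.point (.inr f) s)

/-! ### Bilinear forms and matrices -/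

/-- `∑_κ ∫_κ σ u v dx`. -/
def massForm [Fintype K] (M : CurvedMesh m K I B) (σ : (Fin (m + 1) → ℝ) → ℝ)
    (u v : M.DGSpace t r) : ℝ :=
  ∑ k, ∫ x in M.cell k, σ x * M.val u k x * M.val v k x

/-- `∑_κ ∫_κ (∂ⱼ u) v dx`. -/
def gradForm [Fintype K] (M : CurvedMesh m K I B) (j : Fin (m + 1)) (u v : M.DGSpace t r) : ℝ :=
  ∑ k, ∫ x in M.cell k, fderiv ℝ (M.val u k) x (Pi.single j 1) * M.val v k x

/-- `-∑_Γ ∫_Γ (ω·n) ⟦u⟧ {v} dS + ½ ∑_Γ ∫_Γ |ω·n| ⟦u⟧ ⟦v⟧ dS`. -/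
def upwindForm [Fintype I] [Fintype B] (M : CurvedMesh m K I B) (θ : ℝ) (ω : Fin (m + 1) → ℝ)
    (u v : M.DGSpace t r) : ℝ :=
  -(∑ Γ, M.faceIntegral Γ fun s => (ω ⬝ᵥ M.normal Γ s) * M.jump u Γ s * M.avg θ v Γ s)
    + 1 / 2 * ∑ Γ, M.faceIntegral Γ fun s => |ω ⬝ᵥ M.normal Γ s| * M.jump u Γ s * M.jump v Γ s

/-- `∑_Γ ∫_Γ (ω·n) {u} ⟦v⟧ dS + ½ ∑_Γ ∫_Γ |ω·n| ⟦u⟧ ⟦v⟧ dS`. -/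
def upwindFormTilde [Fintype I] [Fintype B] (M : CurvedMesh m K I B) (θ : ℝ)
    (ω : Fin (m + 1) → ℝ) (u v : M.DGSpace t r) : ℝ :=
  (∑ Γ, M.faceIntegral Γ fun s => (ω ⬝ᵥ M.normal Γ s) * M.avg θ u Γ s * M.jump v Γ s)
    + 1 / 2 * ∑ Γ, M.faceIntegral Γ fun s => |ω ⬝ᵥ M.normal Γ s| * M.jump u Γ s * M.jump v Γ s

/-- The matrix `A` of a bilinear form `a` in the basis `b`: `vᵀ A u = a(u, v)`. -/
def formMatrix {ι V : Type} [AddCommGroup V] [Module ℝ V] (b : Module.Basis ι ℝ V)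
    (a : V → V → ℝ) : Matrix ι ι ℝ :=
  Matrix.of fun i j => a (b j) (b i)

end CurvedMesh

/-! ### Angular quadrature -/

/-- An angular quadrature on the unit sphere of `ℝ³`, exact for the moments of order `0, 1, 2`. -/
structure AngularQuadrature (δ : Type) [Fintype δ] where
  dir : δ → Fin 3 → ℝ
  weight : δ → ℝ
  dir_unit : ∀ d, dir d ⬝ᵥ dir d = 1
  weight_pos : ∀ d, 0 < weight d
  sum_weight : ∑ d, weight d = 4 * Real.pi
  sum_dir : ∑ d, weight d • dir d = 0
  sum_dir_dir : ∑ d, weight d • Matrix.vecMulVec (dir d) (dir d)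
    = (4 * Real.pi / 3) • (1 : Matrix (Fin 3) (Fin 3) ℝ)

variable {δ : Type} [Fintype δ]

/-- The components of the direction `Ω_d` along the `m + 1 ≤ 3` space variables. -/
def AngularQuadrature.Ω (Q : AngularQuadrature δ) (hm : m + 1 ≤ 3) (d : δ) : Fin (m + 1) → ℝ :=
  fun j => Q.dir d (Fin.castLE hm j)

/-- `α = (1/4π) ∑_d w_d |Ω_d·n|` at a point of a face. -/
def CurvedMesh.alpha (M : CurvedMesh m K I B) (Q : AngularQuadrature δ) (hm : m + 1 ≤ 3)
    (Γ : I ⊕ B) (s : Fin m → ℝ) : ℝ :=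
  1 / (4 * Real.pi) * ∑ d, Q.weight d * |Q.Ω hm d ⬝ᵥ M.normal Γ s|

/-! ### The scalar flux source iteration and the DSA matrix -/

/-- The data of the discrete ordinates DG discretization. -/
structure Discretization (m : ℕ) (K I B δ ι : Type) [Fintype δ] where
  dim_le : m + 1 ≤ 3
  mesh : CurvedMesh m K I B
  /-- The kind of the polynomial degree on each reference cell. -/
  kind : RefCell → DegreeKind
  /-- The polynomial degree. -/
  degree : ℕ
  /-- The finite element basis. -/
  basis : Module.Basis ι ℝ (mesh.DGSpace kind degree)
  quad : AngularQuadrature δ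
  /-- The weight of the one-sided value in the average on boundary faces. -/
  θ : ℝ
  σt : (Fin (m + 1) → ℝ) → ℝ
  σa : (Fin (m + 1) → ℝ) → ℝ

namespace Discretization

variable {ι : Type} [Fintype K] [Fintype I] [Fintype B] [Fintype ι] [DecidableEq ι]

/-- The direction `Ω_d`. -/
def Ω (P : Discretization m K I B δ ι) (d : δ) : Fin (m + 1) → ℝ := P.quad.Ω P.dim_le d

/-- The weight `w_d`. -/
def w (P : Discretization m K I B δ ι) (d : δ) : ℝ := P.quad.weight d

/-- The mass matrix weighted with the total opacity. -/
def Mt (P : Discretization m K I B δ ι) : Matrix ι ι ℝ :=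
  CurvedMesh.formMatrix P.basis (P.mesh.massForm P.σt)

/-- The mass matrix weighted with the absorption opacity. -/
def Ma (P : Discretization m K I B δ ι) : Matrix ι ι ℝ :=
  CurvedMesh.formMatrix P.basis (P.mesh.massForm P.σa)

/-- The components of the gradient matrix. -/
def G (P : Discretization m K I B δ ι) (j : Fin (m + 1)) : Matrix ι ι ℝ :=
  CurvedMesh.formMatrix P.basis (P.mesh.gradForm j)

/-- The face matrix `F^(d)`. -/
def F (P : Discretization m K I B δ ι) (d : δ) : Matrix ι ι ℝ :=
  CurvedMesh.formMatrix P.basis (P.mesh.upwindForm P.θ (P.Ω d))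

/-- The face matrix `F̃^(d)`. -/
def Ft (P : Discretization m K I B δ ι) (d : δ) : Matrix ι ι ℝ :=
  CurvedMesh.formMatrix P.basis (P.mesh.upwindFormTilde P.θ (P.Ω d))

/-- `I + ε M_t⁻¹ (Ω_d·G + F^(d))`, the matrix that a transport sweep inverts. -/
def sweep (P : Discretization m K I B δ ι) (ε : ℝ) (d : δ) : Matrix ι ι ℝ :=
  1 + ε • (P.Mt⁻¹ * (∑ j, P.Ω d j • P.G j + P.F d))

/-- The scalar flux source iteration matrix `S_ε`. -/
def S (P : Discretization m K I B δ ι) (ε : ℝ) : Matrix ι ι ℝ :=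
  ∑ d, P.w d • ((P.sweep ε d)⁻¹ * ((1 / (4 * Real.pi)) • (1 - ε ^ 2 • (P.Mt⁻¹ * P.Ma))))

/-- `F₀ = (1/4π) ∑_d w_d F^(d)`. -/
def F0 (P : Discretization m K I B δ ι) : Matrix ι ι ℝ :=
  (1 / (4 * Real.pi)) • ∑ d, P.w d • P.F d

/-- `F₁ = (1/4π) ∑_d w_d Ω_d F^(d)`. -/
def F1 (P : Discretization m K I B δ ι) (j : Fin (m + 1)) : Matrix ι ι ℝ :=
  (1 / (4 * Real.pi)) • ∑ d, (P.w d * P.Ω d j) • P.F d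

/-- `F̃₁ = (1/4π) ∑_d w_d Ω_d F̃^(d)`. -/
def Ft1 (P : Discretization m K I B δ ι) (j : Fin (m + 1)) : Matrix ι ι ℝ :=
  (1 / (4 * Real.pi)) • ∑ d, (P.w d * P.Ω d j) • P.Ft d

/-- `D₀ = (1/3) Gᵀ·M_t⁻¹G - F̃₁·M_t⁻¹G + Gᵀ·M_t⁻¹F₁ + M_a`. -/
def D0 (P : Discretization m K I B δ ι) : Matrix ι ι ℝ :=
  (1 / 3 : ℝ) • ∑ j, (P.G j)ᵀ * P.Mt⁻¹ * P.G j - ∑ j, P.Ft1 j * P.Mt⁻¹ * P.G j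
    + ∑ j, (P.G j)ᵀ * P.Mt⁻¹ * P.F1 j + P.Ma

/-- The SIP DSA matrix `D_ε = ε⁻¹ F₀ + D₀`. -/
def D (P : Discretization m K I B δ ι) (ε : ℝ) : Matrix ι ι ℝ := ε⁻¹ • P.F0 + P.D0

end Discretization

end DGTransport

end

set_option linter.unusedSectionVars false

/-! Expanding each sweep inverse in a Neumann series and averaging over the directions gives `M_t (I
- S_ε) = ε F₀ + ε² (D₀ + E) + O(ε³)`. The vanishing first angular moment removes the streaming term
at first order. The defect `E` (`Discretization.defect`) compares the true second-order coefficient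
with `D₀`.

`F₀` is the matrix of the penalty form `½ ∑ ∫ α ⟦u⟧ ⟦v⟧`, so it is symmetric and positive
semidefinite. As `α` is bounded below, its kernel consists of the functions without jumps that
vanish on the boundary. For such a test vector `x` all face terms drop out, and integration by parts
turns `xᵀ(Ω·G + F)` into `-xᵀ(Ω·G)ᵀ`. With the second angular moment this yields `xᵀE = 0`
(`Conforming.vecMul_defect`). Hence `E = F₀ X` for some constant `X`. Since `F₀ = ε (D_ε - D₀)`, the
product `D_ε⁻¹ E = ε (X - D_ε⁻¹ D₀ X)` is `O(ε)` once `D_ε⁻¹` is bounded.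

That bound comes from coercivity: on `ker F₀` the form of `D₀` is `⅓ ∑ (G_j x)ᵀ M_t⁻¹ (G_j x) + xᵀ
M_a x`, and if it is positive for `x ≠ 0` there, then `ε⁻¹ F₀ + D₀` is coercive uniformly for small
`ε` (`exists_coercive`). A vector of `ker F₀` with zero form satisfies `G_j x = 0` and `M_a x = 0`.
It vanishes if `σ_a > 0`. On affine cells it vanishes because the gradient may be used as its own
test function. Otherwise it lies in the kernel of every `D_ε`, so one nonsingular `D_ε` excludes it.

The analytic core is the divergence theorem on a curved mesh: Fubini on the reference cells, the
Piola identity, and cancellation of the two sides of an interior face under reparametrization. -/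

namespace DGTransport

/-! ### Linear algebra: factorization, coercivity, bounded inverses, truncated Neumann series. -/

section LinearAlgebra

variable {ι : Type} [Fintype ι] [DecidableEq ι]

/-- For symmetric `A` the range is the orthogonal complement of the kernel, so the hypothesis says
that the columns of `E` lie in the range of `A`. -/
theorem exists_mul_eq_of_ker_le (A E : Matrix ι ι ℝ) (hA : Aᵀ = A)
    (h : ∀ v, A *ᵥ v = 0 → v ᵥ* E = 0) : ∃ X, A * X = E := by
  have hker : LinearMap.ker (Matrix.toLin' A) ≤ LinearMap.ker (Matrix.toLin' Eᵀ) := by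
    intro v hv
    simp only [LinearMap.mem_ker, Matrix.toLin'_apply] at hv ⊢
    rw [Matrix.mulVec_transpose]
    exact h v hv
  -- `Eᵀ` factors through the quotient by `ker A`, that is, through the range of `A`. Extending the
  -- factor to the whole space gives `g` with `g A = Eᵀ`, and `X = gᵀ`.
  obtain ⟨g, hg⟩ := LinearMap.exists_extend
    ((LinearMap.ker (Matrix.toLin' A)).liftQ _ hker ∘ₗ
      (Matrix.toLin' A).quotKerEquivRange.symm.toLinearMap)
  refine ⟨(LinearMap.toMatrix' g)ᵀ, ?_⟩
  have : LinearMap.toMatrix' g * A = Eᵀ := by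
    apply Matrix.toLin'.injective
    rw [Matrix.toLin'_mul, Matrix.toLin'_toMatrix']
    refine LinearMap.ext fun v => ?_
    have h1 := congrArg (fun f => f ⟨Matrix.toLin' A v, LinearMap.mem_range_self _ _⟩) hg
    simp only [LinearMap.comp_apply, Submodule.subtype_apply, LinearEquiv.coe_coe] at h1
    have h2 : (Matrix.toLin' A).quotKerEquivRange.symm
        ⟨Matrix.toLin' A v, LinearMap.mem_range_self _ _⟩ =
        (LinearMap.ker (Matrix.toLin' A)).mkQ v := by
      rw [LinearEquiv.symm_apply_eq]
      rfl
    rw [h2] at h1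
    simpa using h1
  rw [← Matrix.transpose_transpose (A * _), Matrix.transpose_mul, Matrix.transpose_transpose, hA,
    this, Matrix.transpose_transpose]

omit [DecidableEq ι] in
-- Compactness of the unit sphere: where the form of `B` fails to be positive, that of `A` is
-- bounded away from zero, so a large multiple of `A` compensates. The same `c` then serves every
-- larger multiple.
theorem exists_coercive (A B : Matrix ι ι ℝ) (hA : ∀ x, 0 ≤ x ⬝ᵥ A *ᵥ x)
    (h : ∀ x, x ⬝ᵥ A *ᵥ x = 0 → x ≠ 0 → 0 < x ⬝ᵥ B *ᵥ x) :
    ∃ c t : ℝ, 0 < c ∧ 0 < t ∧ ∀ s ≥ t, ∀ x, c * (x ⬝ᵥ x) ≤ x ⬝ᵥ (s • A + B) *ᵥ x := by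
  have hcont : ∀ C : Matrix ι ι ℝ, Continuous fun x : ι → ℝ => x ⬝ᵥ C *ᵥ x := fun C =>
    Continuous.dotProduct continuous_id (Continuous.matrix_mulVec continuous_const continuous_id)
  set Sp : Set (ι → ℝ) := {x | x ⬝ᵥ x = 1} with hSp
  have hSc : IsCompact Sp := by
    refine Metric.isCompact_of_isClosed_isBounded
      (isClosed_eq (Continuous.dotProduct continuous_id continuous_id) continuous_const) ?_
    refine (Metric.isBounded_closedBall (x := (0 : ι → ℝ)) (r := 1)).subset fun x hx => ?_
    rw [mem_closedBall_zero_iff, pi_norm_le_iff_of_nonneg zero_le_one]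
    intro i
    have h1 : x i * x i ≤ x ⬝ᵥ x :=
      Finset.single_le_sum (f := fun j => x j * x j) (fun j _ => mul_self_nonneg _)
        (Finset.mem_univ i)
    rw [hx] at h1
    rw [Real.norm_eq_abs]
    exact abs_le_one_iff_mul_self_le_one.2 h1
  have hne : ∀ x ∈ Sp, x ≠ 0 := by
    rintro x hx rfl
    simp [hSp] at hx
  obtain ⟨t, ht0, ht⟩ : ∃ t : ℝ, 0 < t ∧ ∀ x ∈ Sp, 0 < t * (x ⬝ᵥ A *ᵥ x) + x ⬝ᵥ B *ᵥ x := by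
    set K := Sp ∩ {x | x ⬝ᵥ B *ᵥ x ≤ 0} with hK
    have hKc : IsCompact K := hSc.inter_right (isClosed_le (hcont B) continuous_const)
    rcases K.eq_empty_or_nonempty with hKe | hKn
    · refine ⟨1, one_pos, fun x hx => ?_⟩
      have : 0 < x ⬝ᵥ B *ᵥ x := by
        by_contra hcon
        have : x ∈ K := ⟨hx, not_lt.1 hcon⟩
        rw [hKe] at this
        exact this
      linarith [hA x]
    · obtain ⟨x₀, hx₀, hmin⟩ := hKc.exists_isMinOn hKn (hcont A).continuousOn
      obtain ⟨x₁, hx₁, hmin₁⟩ := hKc.exists_isMinOn hKn (hcont B).continuousOn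
      have hpos : 0 < x₀ ⬝ᵥ A *ᵥ x₀ := by
        refine lt_of_le_of_ne (hA _) fun h0 => ?_
        exact absurd (h x₀ h0.symm (hne _ hx₀.1)) (not_lt.2 hx₀.2)
      -- On `K` the form of `A` is at least its value at `x₀` and that of `B` at least its value at
      -- `x₁`; this `t` makes the sum at least `1` there.
      refine ⟨(|x₁ ⬝ᵥ B *ᵥ x₁| + 1) / (x₀ ⬝ᵥ A *ᵥ x₀), by positivity, fun x hx => ?_⟩
      by_cases hxB : x ⬝ᵥ B *ᵥ x ≤ 0
      · have h1 : x₀ ⬝ᵥ A *ᵥ x₀ ≤ x ⬝ᵥ A *ᵥ x := hmin ⟨hx, hxB⟩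
        have h2 : x₁ ⬝ᵥ B *ᵥ x₁ ≤ x ⬝ᵥ B *ᵥ x := hmin₁ ⟨hx, hxB⟩
        have h3 : |x₁ ⬝ᵥ B *ᵥ x₁| + 1 ≤
            (|x₁ ⬝ᵥ B *ᵥ x₁| + 1) / (x₀ ⬝ᵥ A *ᵥ x₀) * (x ⬝ᵥ A *ᵥ x) := by
          rw [div_mul_eq_mul_div, le_div_iff₀ hpos]
          gcongr
        linarith [neg_abs_le (x₁ ⬝ᵥ B *ᵥ x₁)]
      · have : 0 ≤ (|x₁ ⬝ᵥ B *ᵥ x₁| + 1) / (x₀ ⬝ᵥ A *ᵥ x₀) * (x ⬝ᵥ A *ᵥ x) :=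
          mul_nonneg (by positivity) (hA x)
        linarith [not_le.1 hxB]
  obtain ⟨c, hc0, hc⟩ : ∃ c : ℝ, 0 < c ∧ ∀ x ∈ Sp, c ≤ t * (x ⬝ᵥ A *ᵥ x) + x ⬝ᵥ B *ᵥ x := by
    rcases Sp.eq_empty_or_nonempty with hS | hS
    · exact ⟨1, one_pos, by simp [hS]⟩
    · obtain ⟨x₀, hx₀, hmin⟩ := hSc.exists_isMinOn hS
        (f := fun x => t * (x ⬝ᵥ A *ᵥ x) + x ⬝ᵥ B *ᵥ x)
        ((continuous_const.mul (hcont A)).add (hcont B)).continuousOn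
      exact ⟨_, ht x₀ hx₀, fun x hx => hmin hx⟩
  refine ⟨c, t, hc0, ht0, fun s hs x => ?_⟩
  rcases eq_or_ne x 0 with rfl | hx
  · simp
  have hxx : 0 < x ⬝ᵥ x := by
    refine lt_of_le_of_ne (Finset.sum_nonneg fun i _ => mul_self_nonneg _) fun h0 => hx ?_
    exact dotProduct_self_eq_zero.1 h0.symm
  set a := √(x ⬝ᵥ x) with ha
  have ha0 : 0 < a := Real.sqrt_pos.2 hxx
  have haa : a * a = x ⬝ᵥ x := Real.mul_self_sqrt hxx.le
  have hmem : a⁻¹ • x ∈ Sp := by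
    simp only [hSp, Set.mem_ofPred_eq, smul_dotProduct, dotProduct_smul, smul_eq_mul, ← haa]
    field_simp
  have := hc _ hmem
  simp only [Matrix.mulVec_smul, smul_dotProduct, dotProduct_smul, smul_eq_mul] at this
  have h2 : c * (x ⬝ᵥ x) ≤ t * (x ⬝ᵥ A *ᵥ x) + x ⬝ᵥ B *ᵥ x := by
    have := mul_le_mul_of_nonneg_left this (mul_self_nonneg a)
    rw [← haa]
    calc c * (a * a) = a * a * c := by ring
      _ ≤ _ := this
      _ = _ := by field_simp
  rw [Matrix.add_mulVec, Matrix.smul_mulVec, dotProduct_add, dotProduct_smul, smul_eq_mul]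
  nlinarith [hA x]

theorem isUnit_of_coercive (A : Matrix ι ι ℝ) {c : ℝ} (hc : 0 < c)
    (h : ∀ x, c * (x ⬝ᵥ x) ≤ x ⬝ᵥ A *ᵥ x) : IsUnit A := by
  rw [← Matrix.mulVec_injective_iff_isUnit]
  intro x y hxy
  rw [← sub_eq_zero]
  have h1 : A *ᵥ (x - y) = 0 := by rw [Matrix.mulVec_sub, hxy, sub_self]
  have h2 := h (x - y)
  rw [h1, dotProduct_zero] at h2
  have h3 : 0 ≤ (x - y) ⬝ᵥ (x - y) := Finset.sum_nonneg fun i _ => mul_self_nonneg _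
  exact dotProduct_self_eq_zero.1 (le_antisymm (by nlinarith) h3)

/-- With `y` the `j`-th column of the inverse, `c |y|² ≤ y · A y = y_j ≤ |y|`, hence `|y| ≤ 1/c`.
The bound depends on `A` only through `c`, which makes it uniform in `ε`. -/
theorem abs_inv_apply_le_of_coercive (A : Matrix ι ι ℝ) {c : ℝ} (hc : 0 < c)
    (h : ∀ x, c * (x ⬝ᵥ x) ≤ x ⬝ᵥ A *ᵥ x) (i j : ι) : |A⁻¹ i j| ≤ c⁻¹ := by
  have hu := isUnit_of_coercive A hc h
  set y := A⁻¹ *ᵥ Pi.single j 1 with hy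
  have hyi : ∀ i, y i = A⁻¹ i j := fun i => by simp [hy]
  have hAy : A *ᵥ y = Pi.single j 1 := by
    rw [hy, Matrix.mulVec_mulVec, Matrix.mul_nonsing_inv _ ((Matrix.isUnit_iff_isUnit_det _).1 hu),
      Matrix.one_mulVec]
  have h1 := h y
  rw [hAy, dotProduct_single, mul_one] at h1
  have hle : ∀ i, y i * y i ≤ y ⬝ᵥ y := fun i =>
    Finset.single_le_sum (f := fun j => y j * y j) (fun j _ => mul_self_nonneg _)
      (Finset.mem_univ i)
  have hj : c * y j ≤ 1 := by
    by_contra hcon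
    nlinarith [hle j, mul_le_mul_of_nonneg_left (hle j) hc.le, mul_self_nonneg (y j)]
  have h2 : y ⬝ᵥ y ≤ c⁻¹ * c⁻¹ := by
    have : y j ≤ c⁻¹ := by rw [← one_div, le_div_iff₀ hc]; linarith
    have h3 : y ⬝ᵥ y ≤ c⁻¹ * y j := by
      rw [inv_mul_eq_div, le_div_iff₀ hc]; linarith
    exact h3.trans (by gcongr)
  rw [← hyi, ← abs_of_pos (inv_pos.2 hc)]
  exact abs_le_iff_mul_self_le.2 ((hle i).trans h2)

/-- The entries of a matrix function are bounded along a filter. -/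
def EntriesBounded (l : Filter ℝ) (f : ℝ → Matrix ι ι ℝ) : Prop :=
  ∀ i j, (fun ε => f ε i j) =O[l] fun _ => (1 : ℝ)

namespace EntriesBounded

variable {l : Filter ℝ} {f g : ℝ → Matrix ι ι ℝ}

omit [Fintype ι] [DecidableEq ι] in
theorem const (A : Matrix ι ι ℝ) : EntriesBounded l fun _ => A := fun _ _ =>
  Asymptotics.isBigO_const_const _ one_ne_zero _

omit [Fintype ι] [DecidableEq ι] in
theorem add (hf : EntriesBounded l f) (hg : EntriesBounded l g) :
    EntriesBounded l fun ε => f ε + g ε := fun i j => (hf i j).add (hg i j)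

omit [Fintype ι] [DecidableEq ι] in
theorem sub (hf : EntriesBounded l f) (hg : EntriesBounded l g) :
    EntriesBounded l fun ε => f ε - g ε := fun i j => (hf i j).sub (hg i j)

omit [Fintype ι] [DecidableEq ι] in
theorem smul {c : ℝ → ℝ} (hc : c =O[l] fun _ => (1 : ℝ)) (hf : EntriesBounded l f) :
    EntriesBounded l fun ε => c ε • f ε := fun i j => by
  simpa using hc.mul (hf i j)

omit [DecidableEq ι] in
theorem mul (hf : EntriesBounded l f) (hg : EntriesBounded l g) :
    EntriesBounded l fun ε => f ε * g ε := fun i j => by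
  simp only [Matrix.mul_apply]
  exact Asymptotics.IsBigO.fun_sum fun k _ => by simpa using (hf i k).mul (hg k j)

omit [Fintype ι] [DecidableEq ι] in
theorem sum {δ : Type} [Fintype δ] {f : δ → ℝ → Matrix ι ι ℝ}
    (hf : ∀ d, EntriesBounded l (f d)) : EntriesBounded l fun ε => ∑ d, f d ε := fun i j => by
  simp only [Matrix.sum_apply]
  exact Asymptotics.IsBigO.fun_sum fun k _ => hf k i j

end EntriesBounded

theorem eventually_isUnit_one_add_smul (A : Matrix ι ι ℝ) :
    ∀ᶠ ε in nhds (0 : ℝ), IsUnit (1 + ε • A) := by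
  have hc : Continuous fun ε : ℝ => (1 + ε • A).det :=
    (continuous_const.add (continuous_id.smul continuous_const)).matrix_det
  have h := hc.continuousAt.eventually_ne (x := (0 : ℝ)) (y := 0) (by simp)
  filter_upwards [h] with ε hε
  rw [Matrix.isUnit_iff_isUnit_det]
  exact hε.isUnit

theorem entriesBounded_inv_one_add_smul (A : Matrix ι ι ℝ) :
    EntriesBounded (nhds 0) fun ε : ℝ => (1 + ε • A)⁻¹ := fun i j => by
  have hc : Continuous fun ε : ℝ => (1 + ε • A) :=
    continuous_const.add (continuous_id.smul continuous_const)
  have h : ContinuousAt (fun ε : ℝ => ((1 + ε • A).det)⁻¹ * (1 + ε • A).adjugate i j) 0 :=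
    (hc.matrix_det.continuousAt.inv₀ (by simp)).mul
      (hc.matrix_adjugate.matrix_elem i j).continuousAt
  refine (Filter.Tendsto.isBigO_one ℝ h.tendsto).congr_left fun ε => ?_
  simp [Matrix.inv_def]

/-- The Neumann series cut after second order, with an exact remainder: the identity `Y = 1 - ε A Y`
inserted into itself three times. -/
theorem inv_one_add_smul_eq (A : Matrix ι ι ℝ) {ε : ℝ} (h : IsUnit (1 + ε • A)) :
    (1 + ε • A)⁻¹ = 1 - ε • A + ε ^ 2 • (A * A) - ε ^ 3 • (A * A * A * (1 + ε • A)⁻¹) := by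
  set Y := (1 + ε • A)⁻¹ with hY
  have h1 : Y = 1 - ε • (A * Y) := by
    have : (1 + ε • A) * Y = 1 :=
      Matrix.mul_nonsing_inv _ ((Matrix.isUnit_iff_isUnit_det _).1 h)
    rw [add_mul, one_mul, smul_mul_assoc] at this
    rw [← this]; abel
  have h2 : A * Y = A - ε • (A * A * Y) := by
    conv_lhs => rw [h1]
    rw [mul_sub, mul_one, mul_smul_comm, mul_assoc]
  have h3 : A * A * Y = A * A - ε • (A * A * A * Y) := by
    conv_lhs => rw [h1]
    rw [mul_sub, mul_one, mul_smul_comm, ← mul_assoc (A * A)]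
  conv_lhs => rw [h1, h2, h3]
  module

end LinearAlgebra

/-! ### The asymptotic expansion and the theorem at the level of matrices. -/

namespace Discretization

variable {m : ℕ} {K I B δ ι : Type} [Fintype K] [Fintype I] [Fintype B] [Fintype δ] [Fintype ι]
  [DecidableEq ι] (P : Discretization m K I B δ ι)

theorem sum_w : ∑ d, P.w d = 4 * Real.pi := P.quad.sum_weight

theorem sum_w_Ω (j : Fin (m + 1)) : ∑ d, P.w d * P.Ω d j = 0 := by
  have := congrFun P.quad.sum_dir (Fin.castLE P.dim_le j)
  simp only [Finset.sum_apply, Pi.smul_apply, smul_eq_mul, Pi.zero_apply] at this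
  exact this

theorem sum_w_Ω_Ω (i j : Fin (m + 1)) :
    ∑ d, P.w d * (P.Ω d i * P.Ω d j) = if i = j then 4 * Real.pi / 3 else 0 := by
  have := congrFun (congrFun P.quad.sum_dir_dir (Fin.castLE P.dim_le i)) (Fin.castLE P.dim_le j)
  simp only [Matrix.sum_apply, Matrix.smul_apply, Matrix.vecMulVec_apply, smul_eq_mul,
    Matrix.one_apply, Fin.castLE_inj] at this
  rw [mul_ite, mul_one, mul_zero] at this
  exact this

/-- The streaming matrix `Ω_d·G`. -/
noncomputable def stream (d : δ) : Matrix ι ι ℝ := ∑ j, P.Ω d j • P.G j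

/-- The transport matrix `M_t⁻¹ (Ω_d·G + F^(d))`. -/
noncomputable def transport (d : δ) : Matrix ι ι ℝ := P.Mt⁻¹ * (P.stream d + P.F d)

theorem sweep_eq (ε : ℝ) (d : δ) : P.sweep ε d = 1 + ε • P.transport d := rfl

theorem sum_w_stream : ∑ d, P.w d • P.stream d = 0 := by
  simp only [stream, Finset.smul_sum, smul_smul]
  rw [Finset.sum_comm]
  simp only [← Finset.sum_smul, sum_w_Ω, zero_smul, Finset.sum_const_zero]

/-- The first angular moment vanishes, so streaming averages out and only the face terms remain at
first order in `ε`. -/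
theorem sum_w_transport : (1 / (4 * Real.pi)) • ∑ d, P.w d • P.transport d = P.Mt⁻¹ * P.F0 := by
  simp only [transport, F0, ← mul_smul_comm, ← Finset.mul_sum, smul_add, Finset.sum_add_distrib,
    sum_w_stream, zero_add]

/-- The second angular moment is isotropic; this is the origin of the factor `1/3` in the diffusion
matrix. -/
theorem sum_stream_transpose_mul_stream (N : Matrix ι ι ℝ) :
    (1 / (4 * Real.pi)) • ∑ d, P.w d • ((P.stream d)ᵀ * N * P.stream d)
      = (1 / 3 : ℝ) • ∑ j, (P.G j)ᵀ * N * P.G j := by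
  have h : ∑ d, P.w d • ((P.stream d)ᵀ * N * P.stream d) =
      ∑ i, ∑ j, (∑ d, P.w d * (P.Ω d i * P.Ω d j)) • ((P.G i)ᵀ * N * P.G j) := by
    simp only [stream, Matrix.transpose_sum, Matrix.transpose_smul, Finset.sum_mul, Finset.mul_sum,
      smul_mul_assoc, mul_smul_comm, Finset.smul_sum, Finset.sum_smul, smul_smul]
    rw [Finset.sum_comm, Finset.sum_comm (s := Finset.univ (α := Fin (m + 1)))
      (t := Finset.univ (α := Fin (m + 1)))]
    refine Finset.sum_congr rfl fun i _ => ?_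
    rw [Finset.sum_comm]
    simp only [mul_comm (P.Ω _ i)]
  rw [h]
  simp only [sum_w_Ω_Ω, ite_smul, zero_smul, Finset.sum_ite_eq, Finset.mem_univ, if_true,
    ← Finset.smul_sum, smul_smul]
  congr 1
  field_simp

theorem sum_stream_transpose_mul_F (N : Matrix ι ι ℝ) :
    (1 / (4 * Real.pi)) • ∑ d, P.w d • ((P.stream d)ᵀ * N * P.F d)
      = ∑ j, (P.G j)ᵀ * N * P.F1 j := by
  simp only [stream, F1, Matrix.transpose_sum, Matrix.transpose_smul, Finset.sum_mul,
    Finset.mul_sum, smul_mul_assoc, mul_smul_comm, Finset.smul_sum, smul_smul]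
  rw [Finset.sum_comm]

/-- The defect of the diffusion matrix at second order in `ε`. -/
noncomputable def defect : Matrix ι ι ℝ :=
  P.Ma - P.Mt * ((1 / (4 * Real.pi)) • ∑ d, P.w d • (P.transport d * P.transport d)) - P.D0

/-- Vectors in the kernel of `F₀` represent functions that are continuous and vanish on the
boundary: face terms vanish on them, and integration by parts produces no face terms. -/
structure Conforming (x : ι → ℝ) : Prop where
  F_mulVec : ∀ d, P.F d *ᵥ x = 0
  vecMul_Ft : ∀ d, x ᵥ* P.Ft d = 0
  vecMul_stream : ∀ d, x ᵥ* (P.stream d + P.F d) = -(x ᵥ* (P.stream d)ᵀ)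

variable {P}

theorem Conforming.vecMul_Ft1 {x : ι → ℝ} (hx : P.Conforming x) (j : Fin (m + 1)) :
    x ᵥ* P.Ft1 j = 0 := by
  simp [Ft1, Matrix.vecMul_smul, Matrix.vecMul_sum, hx.vecMul_Ft]

theorem Conforming.F1_mulVec {x : ι → ℝ} (hx : P.Conforming x) (j : Fin (m + 1)) :
    P.F1 j *ᵥ x = 0 := by
  simp [F1, Matrix.smul_mulVec, Matrix.sum_mulVec, hx.F_mulVec]

theorem Conforming.vecMul_D0 {x : ι → ℝ} (hx : P.Conforming x) :
    x ᵥ* P.D0 = x ᵥ* ((1 / 3 : ℝ) • ∑ j, (P.G j)ᵀ * P.Mt⁻¹ * P.G j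
      + ∑ j, (P.G j)ᵀ * P.Mt⁻¹ * P.F1 j + P.Ma) := by
  have : x ᵥ* (∑ j, P.Ft1 j * P.Mt⁻¹ * P.G j) = 0 := by
    rw [Matrix.vecMul_sum]
    refine Finset.sum_eq_zero fun j _ => ?_
    rw [← Matrix.vecMul_vecMul, ← Matrix.vecMul_vecMul, hx.vecMul_Ft1, Matrix.zero_vecMul,
      Matrix.zero_vecMul]
  simp only [D0, Matrix.vecMul_add, Matrix.vecMul_sub, this, sub_zero]

/-- Tested with `x`, the left factor `Ω·G + F` of the squared transport matrix becomes `-(Ω·G)ᵀ`.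
The angular averages of `(Ω·G)ᵀ M_t⁻¹ (Ω·G)` and `(Ω·G)ᵀ M_t⁻¹ F` are then exactly the terms of `D₀`
that survive the test with `x`. -/
theorem Conforming.vecMul_defect {x : ι → ℝ} (hx : P.Conforming x) (hM : IsUnit P.Mt) :
    x ᵥ* P.defect = 0 := by
  have hMM : P.Mt * P.Mt⁻¹ = 1 :=
    Matrix.mul_nonsing_inv _ ((Matrix.isUnit_iff_isUnit_det _).1 hM)
  have h1 : x ᵥ* (P.Mt * ((1 / (4 * Real.pi)) • ∑ d, P.w d • (P.transport d * P.transport d)))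
      = -(x ᵥ* ((1 / 3 : ℝ) • ∑ j, (P.G j)ᵀ * P.Mt⁻¹ * P.G j
        + ∑ j, (P.G j)ᵀ * P.Mt⁻¹ * P.F1 j)) := by
    rw [← sum_stream_transpose_mul_stream, ← sum_stream_transpose_mul_F, ← smul_add,
      ← Finset.sum_add_distrib, mul_smul_comm, Matrix.vecMul_smul, Matrix.vecMul_smul, ← smul_neg,
      Finset.mul_sum, Matrix.vecMul_sum, Matrix.vecMul_sum, ← Finset.sum_neg_distrib]
    congr 1
    refine Finset.sum_congr rfl fun d _ => ?_
    rw [mul_smul_comm, ← smul_add, Matrix.vecMul_smul, Matrix.vecMul_smul, ← smul_neg, transport,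
      ← mul_assoc, ← mul_assoc, ← mul_assoc, hMM, one_mul, ← mul_add, mul_assoc (P.stream d + P.F d),
      ← Matrix.vecMul_vecMul,
      hx.vecMul_stream, Matrix.neg_vecMul, Matrix.vecMul_vecMul, mul_assoc]
  rw [defect, Matrix.vecMul_sub, Matrix.vecMul_sub, h1, hx.vecMul_D0]
  simp only [Matrix.vecMul_add]
  abel

/-- The `F̃₁` term is killed from the left and the `F₁` term from the right; two nonnegative
contributions remain when `M_t` is positive definite and `M_a` positive semidefinite. -/
theorem Conforming.D0_form {x : ι → ℝ} (hx : P.Conforming x) :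
    x ⬝ᵥ P.D0 *ᵥ x = 1 / 3 * ∑ j, (P.G j *ᵥ x) ⬝ᵥ P.Mt⁻¹ *ᵥ (P.G j *ᵥ x) + x ⬝ᵥ P.Ma *ᵥ x := by
  rw [Matrix.dotProduct_mulVec, hx.vecMul_D0, ← Matrix.dotProduct_mulVec, Matrix.add_mulVec,
    Matrix.add_mulVec, dotProduct_add, dotProduct_add, Matrix.smul_mulVec, dotProduct_smul,
    Matrix.sum_mulVec, Matrix.sum_mulVec, dotProduct_sum, dotProduct_sum]
  have h2 : ∀ j, x ⬝ᵥ ((P.G j)ᵀ * P.Mt⁻¹ * P.F1 j) *ᵥ x = 0 := fun j => by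
    rw [← Matrix.mulVec_mulVec, hx.F1_mulVec, Matrix.mulVec_zero, dotProduct_zero]
  have h1 : ∀ j, x ⬝ᵥ ((P.G j)ᵀ * P.Mt⁻¹ * P.G j) *ᵥ x
      = (P.G j *ᵥ x) ⬝ᵥ P.Mt⁻¹ *ᵥ (P.G j *ᵥ x) := fun j => by
    rw [← Matrix.mulVec_mulVec, ← Matrix.mulVec_mulVec, Matrix.dotProduct_mulVec,
      Matrix.vecMul_transpose]
  simp only [h1, h2, Finset.sum_const_zero, add_zero, smul_eq_mul]

theorem Conforming.D0_mulVec {x : ι → ℝ} (hx : P.Conforming x) (hG : ∀ j, P.G j *ᵥ x = 0)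
    (hMa : P.Ma *ᵥ x = 0) : P.D0 *ᵥ x = 0 := by
  simp [D0, Matrix.add_mulVec, Matrix.sub_mulVec, Matrix.smul_mulVec, Matrix.sum_mulVec,
    ← Matrix.mulVec_mulVec, hG, hMa, hx.F1_mulVec]

/-- Both `F₀` and `D₀` annihilate such an `x`, so it lies in the kernel of `D_ε` for every `ε`;
nonsingularity at a single value excludes it. -/
theorem Conforming.eq_zero_of_isUnit_D {x : ι → ℝ} (hx : P.Conforming x) (hF0 : P.F0 *ᵥ x = 0)
    (hG : ∀ j, P.G j *ᵥ x = 0) (hMa : P.Ma *ᵥ x = 0) {ε : ℝ} (hD : IsUnit (P.D ε)) : x = 0 := by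
  apply Matrix.mulVec_injective_iff_isUnit.2 hD
  rw [Matrix.mulVec_zero, D, Matrix.add_mulVec, hx.D0_mulVec hG hMa, Matrix.smul_mulVec, hF0,
    smul_zero, add_zero]

theorem exists_remainder (hM : IsUnit P.Mt) :
    ∃ R : ℝ → Matrix ι ι ℝ, EntriesBounded (nhds 0) R ∧ ∀ᶠ ε in nhds (0 : ℝ),
      (∀ d, IsUnit (P.sweep ε d)) ∧
      P.Mt * (1 - P.S ε) = ε • P.F0 + ε ^ 2 • P.D0 + ε ^ 2 • P.defect + ε ^ 3 • R ε := by
  have hMM : P.Mt * P.Mt⁻¹ = 1 :=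
    Matrix.mul_nonsing_inv _ ((Matrix.isUnit_iff_isUnit_det _).1 hM)
  set Q := (1 / (4 * Real.pi)) • ∑ d, P.w d • (P.transport d * P.transport d) with hQ
  set R₁ : ℝ → Matrix ι ι ℝ := fun ε => (1 / (4 * Real.pi)) • ∑ d, P.w d •
    (P.transport d * P.transport d * P.transport d * (1 + ε • P.transport d)⁻¹) with hR₁
  have hbR₁ : EntriesBounded (nhds 0) R₁ :=
    .smul (Asymptotics.isBigO_const_const _ one_ne_zero _) <| .sum fun d =>
      .smul (Asymptotics.isBigO_const_const _ one_ne_zero _) <|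
        .mul (.const _) (entriesBounded_inv_one_add_smul _)
  have hid : (fun ε : ℝ => ε) =O[nhds 0] fun _ => (1 : ℝ) :=
    Filter.Tendsto.isBigO_one ℝ continuous_id.continuousAt.tendsto
  have hid2 : (fun ε : ℝ => ε ^ 2) =O[nhds 0] fun _ => (1 : ℝ) :=
    Filter.Tendsto.isBigO_one ℝ (continuous_id.pow 2).continuousAt.tendsto
  -- Third-order terms have two sources: the tail `R₁` of the averaged Neumann series, and the
  -- product of `ε² M_t⁻¹ M_a` with all that the averaged inverse contains beyond the identity.
  refine ⟨fun ε => P.Mt * R₁ ε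
    + P.Mt * (ε • Q - ε ^ 2 • R₁ ε - P.Mt⁻¹ * P.F0) * (P.Mt⁻¹ * P.Ma), ?_, ?_⟩
  · exact (EntriesBounded.mul (.const _) hbR₁).add <| .mul (.mul (.const _)
      (((EntriesBounded.const Q).smul hid).sub (hbR₁.smul hid2) |>.sub (.const _))) (.const _)
  filter_upwards [Filter.eventually_all.2 fun d =>
    eventually_isUnit_one_add_smul (P.transport d)] with ε hε
  refine ⟨fun d => hε d, ?_⟩
  have hS : P.S ε = (1 - ε • (P.Mt⁻¹ * P.F0) + ε ^ 2 • Q - ε ^ 3 • R₁ ε) *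
      (1 - ε ^ 2 • (P.Mt⁻¹ * P.Ma)) := by
    have : (1 / (4 * Real.pi)) • ∑ d, P.w d • (1 + ε • P.transport d)⁻¹
        = 1 - ε • (P.Mt⁻¹ * P.F0) + ε ^ 2 • Q - ε ^ 3 • R₁ ε := by
      have hd : ∀ d, P.w d • (1 + ε • P.transport d)⁻¹ = P.w d • (1 : Matrix ι ι ℝ)
          - ε • (P.w d • P.transport d) + ε ^ 2 • (P.w d • (P.transport d * P.transport d))
          - ε ^ 3 • (P.w d • (P.transport d * P.transport d * P.transport d *
            (1 + ε • P.transport d)⁻¹)) := fun d => by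
        conv_lhs => rw [inv_one_add_smul_eq _ (hε d)]
        module
      simp only [hd, Finset.sum_sub_distrib, Finset.sum_add_distrib, ← Finset.smul_sum,
        ← Finset.sum_smul, sum_w]
      rw [← sum_w_transport, hQ, hR₁]
      have h1 : (1 / (4 * Real.pi)) • ((4 * Real.pi) • (1 : Matrix ι ι ℝ)) = 1 := by
        rw [smul_smul, one_div_mul_cancel (by positivity), one_smul]
      simp only [smul_sub, smul_add, h1, smul_comm (1 / (4 * Real.pi)) (ε : ℝ),
        smul_comm (1 / (4 * Real.pi)) (ε ^ 2 : ℝ), smul_comm (1 / (4 * Real.pi)) (ε ^ 3 : ℝ)]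
    rw [← this, S, Finset.smul_sum, Finset.sum_mul]
    refine Finset.sum_congr rfl fun d _ => ?_
    rw [sweep_eq, mul_smul_comm, smul_mul_assoc, smul_mul_assoc, smul_comm]
  have e1 : P.Mt * (P.Mt⁻¹ * P.F0) = P.F0 := by rw [← mul_assoc, hMM, one_mul]
  have e2 : P.Mt * (P.Mt⁻¹ * P.Ma) = P.Ma := by rw [← mul_assoc, hMM, one_mul]
  rw [hS, defect, ← hQ]
  simp only [mul_sub, sub_mul, mul_add, add_mul, mul_one, one_mul, smul_mul_assoc, mul_smul_comm,
    e1, e2, mul_assoc, smul_sub, smul_add]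
  rw [← mul_assoc P.Mt P.Mt⁻¹ (P.F0 * _), hMM, one_mul]
  module

/-- All that the matrix argument needs from the discretization: definiteness, conformity of `ker
F₀`, and no nonzero vector killed by `F₀`, all `G_j` and `M_a`. The remaining sections supply these
facts. -/
theorem theorem_of_matrix_hypotheses (hM : P.Mt.PosDef) (hMa : P.Ma.PosSemidef)
    (hF0 : P.F0.PosSemidef) (hconf : ∀ x, P.F0 *ᵥ x = 0 → P.Conforming x)
    (hdef : ∀ x, P.F0 *ᵥ x = 0 → (∀ j, P.G j *ᵥ x = 0) → P.Ma *ᵥ x = 0 → x = 0) :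
    ∃ C ε₀ : ℝ, 0 < ε₀ ∧ ∀ ε : ℝ, 0 < ε → ε < ε₀ →
      (∀ d, IsUnit (P.sweep ε d)) ∧
      IsUnit (P.D ε) ∧
      ∀ i j, |((ε ^ 2 • P.D ε)⁻¹ * P.Mt * (1 - P.S ε) - 1) i j| ≤ C * ε := by
  have hMinv : P.Mt⁻¹.PosDef := hM.inv
  have hzero : ∀ x, x ⬝ᵥ P.F0 *ᵥ x = 0 → P.F0 *ᵥ x = 0 := fun x hx =>
    (hF0.dotProduct_mulVec_zero_iff x).1 (by simpa using hx)
  obtain ⟨c, t, hc, ht, hcoer⟩ := exists_coercive P.F0 P.D0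
    (fun x => by simpa using hF0.dotProduct_mulVec_nonneg x) (by
      intro x hx hx0
      have hx := hzero x hx
      rw [(hconf x hx).D0_form]
      have hG : ∀ j, 0 ≤ (P.G j *ᵥ x) ⬝ᵥ P.Mt⁻¹ *ᵥ (P.G j *ᵥ x) := fun j => by
        simpa using hMinv.posSemidef.dotProduct_mulVec_nonneg (P.G j *ᵥ x)
      have ha : 0 ≤ x ⬝ᵥ P.Ma *ᵥ x := by simpa using hMa.dotProduct_mulVec_nonneg x
      have hs := Finset.sum_nonneg fun j (_ : j ∈ Finset.univ) => hG j
      refine lt_of_le_of_ne (by positivity) fun h0 => hx0 (hdef x hx (fun j => ?_) ?_)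
      · have h1 : ∑ j, (P.G j *ᵥ x) ⬝ᵥ P.Mt⁻¹ *ᵥ (P.G j *ᵥ x) = 0 := by linarith
        have h2 := (Finset.sum_eq_zero_iff_of_nonneg fun j _ => hG j).1 h1 j (Finset.mem_univ j)
        by_contra hne
        have := hMinv.dotProduct_mulVec_pos hne
        simp only [star_trivial] at this
        linarith
      · exact (hMa.dotProduct_mulVec_zero_iff x).1 (by simp only [star_trivial]; linarith))
  -- The defect is divisible by `F₀` on the left, which is what later gains a factor `ε`.
  obtain ⟨X, hX⟩ := exists_mul_eq_of_ker_le P.F0 P.defect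
    (by simpa using hF0.1.eq) fun v hv => (hconf v hv).vecMul_defect hM.isUnit
  obtain ⟨R, hR, hev⟩ := exists_remainder (P := P) hM.isUnit
  have hcoer' : ∀ᶠ ε in nhdsWithin (0 : ℝ) (Set.Ioi 0), ∀ x, c * (x ⬝ᵥ x) ≤ x ⬝ᵥ P.D ε *ᵥ x := by
    have : Set.Ioo 0 t⁻¹ ∈ nhdsWithin (0 : ℝ) (Set.Ioi 0) := Ioo_mem_nhdsGT (inv_pos.2 ht)
    filter_upwards [this] with ε hε x
    -- For `ε < 1/t` the coefficient `ε⁻¹` of `F₀` exceeds the threshold `t`.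
    exact hcoer ε⁻¹ ((le_inv_comm₀ ht hε.1).2 hε.2.le) x
  have hDinv : EntriesBounded (nhdsWithin (0 : ℝ) (Set.Ioi 0)) fun ε => (P.D ε)⁻¹ := fun i j => by
    refine Asymptotics.IsBigO.of_bound c⁻¹ ?_
    filter_upwards [hcoer'] with ε hε
    simpa using abs_inv_apply_le_of_coercive _ hc hε i j
  have hR' : EntriesBounded (nhdsWithin (0 : ℝ) (Set.Ioi 0)) R := fun i j =>
    (hR i j).mono nhdsWithin_le_nhds
  have hY : EntriesBounded (nhdsWithin (0 : ℝ) (Set.Ioi 0)) fun ε =>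
      X - (P.D ε)⁻¹ * (P.D0 * X) + (P.D ε)⁻¹ * R ε :=
    ((EntriesBounded.const X).sub (hDinv.mul (.const _))).add (hDinv.mul hR')
  choose C hC using fun i j => (hY i j).bound
  have hall : ∀ᶠ ε in nhdsWithin (0 : ℝ) (Set.Ioi 0), ∀ i j,
      ‖(X - (P.D ε)⁻¹ * (P.D0 * X) + (P.D ε)⁻¹ * R ε) i j‖ ≤ C i j * ‖(1 : ℝ)‖ :=
    Filter.eventually_all.2 fun i => Filter.eventually_all.2 fun j => hC i j
  have hfin := (hall.and hcoer').and (hev.filter_mono nhdsWithin_le_nhds)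
  obtain ⟨ε₀, hε₀, hsub⟩ := mem_nhdsGT_iff_exists_Ioo_subset.1 hfin
  refine ⟨∑ i, ∑ j, |C i j|, ε₀, hε₀, fun ε h0 h1 => ?_⟩
  obtain ⟨⟨hb, hco⟩, hsw, heq⟩ := hsub ⟨h0, h1⟩
  have hDu := isUnit_of_coercive _ hc hco
  refine ⟨hsw, hDu, fun i j => ?_⟩
  have hDD : (P.D ε)⁻¹ * P.D ε = 1 :=
    Matrix.nonsing_inv_mul _ ((Matrix.isUnit_iff_isUnit_det _).1 hDu)
  have hF : P.F0 = ε • P.D ε - ε • P.D0 := by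
    rw [D, smul_add, smul_smul, mul_inv_cancel₀ h0.ne', one_smul, add_sub_cancel_right]
  have hkey : (ε ^ 2 • P.D ε)⁻¹ * P.Mt * (1 - P.S ε) - 1
      = ε • (X - (P.D ε)⁻¹ * (P.D0 * X) + (P.D ε)⁻¹ * R ε) := by
    have hε2 : ε ^ 2 ≠ 0 := pow_ne_zero _ h0.ne'
    have hinv : (ε ^ 2 • P.D ε)⁻¹ = (ε ^ 2)⁻¹ • (P.D ε)⁻¹ := by
      apply Matrix.inv_eq_left_inv
      rw [smul_mul_assoc, mul_smul_comm, smul_smul, inv_mul_cancel₀ hε2, one_smul, hDD]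
    -- Replacing `F₀` by `ε (D_ε - D₀)` in `F₀ X` makes the contribution of the defect first order,
    -- although `D_ε⁻¹` is merely bounded.
    have h3 : (P.D ε)⁻¹ * P.defect = ε • (X - (P.D ε)⁻¹ * (P.D0 * X)) := by
      rw [← hX, hF, sub_mul, mul_sub, smul_mul_assoc, smul_mul_assoc, mul_smul_comm,
        mul_smul_comm, ← mul_assoc _ (P.D ε), hDD, one_mul, smul_sub]
    have h4 : ε • P.F0 + ε ^ 2 • P.D0 = ε ^ 2 • P.D ε := by
      rw [hF]; module
    rw [hinv, mul_assoc, heq, h4, smul_mul_assoc, mul_add, mul_add, mul_smul_comm, mul_smul_comm,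
      mul_smul_comm, hDD, h3]
    simp only [smul_add, smul_smul]
    have e1 : (ε ^ 2)⁻¹ * ε ^ 2 = 1 := inv_mul_cancel₀ hε2
    have e2 : (ε ^ 2)⁻¹ * ε ^ 3 = ε := by field_simp
    rw [e1, e2, ← mul_assoc, e1, one_mul, one_smul]
    abel
  rw [hkey, Matrix.smul_apply, smul_eq_mul, abs_mul, abs_of_pos h0, mul_comm]
  gcongr
  calc _ ≤ C i j * ‖(1 : ℝ)‖ := hb i j
    _ ≤ |C i j| := by simpa using le_abs_self _
    _ ≤ ∑ j, |C i j| := Finset.single_le_sum (f := fun j => |C i j|) (fun _ _ => abs_nonneg _)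
      (Finset.mem_univ j)
    _ ≤ _ := Finset.single_le_sum (f := fun i => ∑ j, |C i j|)
      (fun _ _ => Finset.sum_nonneg fun _ _ => abs_nonneg _) (Finset.mem_univ i)

end Discretization

/-! ### Integration and the divergence theorem on the reference cells. -/

namespace RefCell

/-- The length of the reference cell in a coordinate direction, over a point of a face. -/
noncomputable def height {m : ℕ} (c : RefCell) (s : Fin m → ℝ) : ℝ :=
  match c with
  | .simplex => 1 - ∑ i, s i
  | .cube => 1

theorem height_nonneg {m : ℕ} (c : RefCell) {s : Fin m → ℝ} (hs : s ∈ c.carrier m) :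
    0 ≤ c.height s := by
  cases c with
  | simplex => exact sub_nonneg.2 hs.2
  | cube => exact zero_le_one

theorem continuous_height {m : ℕ} (c : RefCell) : Continuous (c.height (m := m)) := by
  cases c with
  | simplex => exact continuous_const.sub (continuous_finsetSum _ fun i _ => continuous_apply i)
  | cube => exact continuous_const

theorem carrier_subset_Icc (c : RefCell) (n : ℕ) : c.carrier n ⊆ Set.Icc 0 1 := by
  cases c with
  | simplex =>
    exact fun x hx => ⟨hx.1, fun i =>
      (Finset.single_le_sum (fun j _ => hx.1 j) (Finset.mem_univ i)).trans hx.2⟩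
  | cube => exact subset_rfl

theorem isClosed_carrier (c : RefCell) (n : ℕ) : IsClosed (c.carrier n) := by
  cases c with
  | simplex =>
    exact (isClosed_Ici (a := (0 : Fin n → ℝ))).inter
      (isClosed_le (continuous_finsetSum _ fun i _ => continuous_apply i) continuous_const)
  | cube => exact isClosed_Icc

theorem isCompact_carrier (c : RefCell) (n : ℕ) : IsCompact (c.carrier n) :=
  isCompact_Icc.of_isClosed_subset (c.isClosed_carrier n) (c.carrier_subset_Icc n)

theorem measurableSet_carrier (c : RefCell) (n : ℕ) : MeasurableSet (c.carrier n) :=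
  (c.isClosed_carrier n).measurableSet

theorem convex_carrier (c : RefCell) (n : ℕ) : Convex ℝ (c.carrier n) := by
  cases c with
  | simplex =>
    exact (convex_Ici (0 : Fin n → ℝ)).inter
      (convex_halfSpace_le (f := fun x : Fin n → ℝ => ∑ i, x i)
        ⟨fun x y => by simp [Finset.sum_add_distrib], fun a x => by simp [Finset.mul_sum]⟩ 1)
  | cube => exact convex_Icc _ _

/-- An open box contained in both reference cells. -/
def box (n : ℕ) : Set (Fin n → ℝ) := Set.pi Set.univ fun _ => Set.Ioo 0 (1 / (n + 1 : ℝ))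

theorem isOpen_box (n : ℕ) : IsOpen (box n) := isOpen_set_pi Set.finite_univ fun _ _ => isOpen_Ioo

theorem box_nonempty (n : ℕ) : (box n).Nonempty :=
  Set.univ_pi_nonempty_iff.2 fun _ => Set.nonempty_Ioo.2 (by positivity)

theorem box_subset_carrier (c : RefCell) (n : ℕ) : box n ⊆ c.carrier n := by
  intro x hx
  have h : ∀ i, x i ∈ Set.Ioo (0 : ℝ) (1 / (n + 1 : ℝ)) := fun i => hx i (Set.mem_univ i)
  cases c with
  | simplex =>
    refine ⟨fun i => (h i).1.le, ?_⟩
    calc ∑ i, x i ≤ ∑ _i : Fin n, 1 / (n + 1 : ℝ) := Finset.sum_le_sum fun i _ => (h i).2.le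
      _ = n / (n + 1 : ℝ) := by simp [div_eq_mul_inv]
      _ ≤ 1 := by rw [div_le_one (by positivity)]; linarith
  | cube =>
    refine ⟨fun i => (h i).1.le, fun i => (h i).2.le.trans ?_⟩
    rw [Pi.one_apply, div_le_one (by positivity)]
    linarith [(Nat.cast_nonneg n : (0 : ℝ) ≤ n)]

theorem box_subset_interior (c : RefCell) (n : ℕ) : box n ⊆ interior (c.carrier n) :=
  interior_maximal (c.box_subset_carrier n) (isOpen_box n)

theorem interior_carrier_nonempty (c : RefCell) (n : ℕ) : (interior (c.carrier n)).Nonempty :=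
  (box_nonempty n).mono (c.box_subset_interior n)

/-- The gluing maps of the mesh are differentiable only within the carrier, so their derivatives
must be determined up to its boundary. -/
theorem uniqueDiffOn_carrier (c : RefCell) (n : ℕ) : UniqueDiffOn ℝ (c.carrier n) :=
  uniqueDiffOn_convex (c.convex_carrier n) (c.interior_carrier_nonempty n)

theorem interior_carrier_ae_eq (c : RefCell) (n : ℕ) :
    interior (c.carrier n) =ᵐ[volume] c.carrier n :=
  interior_ae_eq_of_null_frontier ((c.convex_carrier n).addHaar_frontier volume)

/-- In every coordinate direction, both reference cells are the region under the graph of `height`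
over the reference cell one dimension lower. One Fubini argument therefore serves both. -/
theorem insertNth_mem_carrier {m : ℕ} (c : RefCell) (i : Fin (m + 1)) (y : ℝ) (s : Fin m → ℝ) :
    i.insertNth (α := fun _ => ℝ) y s ∈ c.carrier (m + 1) ↔
      s ∈ c.carrier m ∧ y ∈ Set.Icc 0 (c.height s) := by
  cases c with
  | simplex =>
    simp only [carrier, height, Set.mem_ofPred_eq, Fin.forall_iff_succAbove i,
      Fin.insertNth_apply_same, Fin.insertNth_apply_succAbove, Fin.sum_univ_succAbove _ i,
      Set.mem_Icc]
    constructor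
    · rintro ⟨⟨h1, h2⟩, h3⟩
      exact ⟨⟨h2, by linarith⟩, h1, by linarith⟩
    · rintro ⟨⟨h1, h2⟩, h3, h4⟩
      exact ⟨⟨h3, h1⟩, by linarith⟩
  | cube =>
    simp only [carrier, height, Set.mem_Icc, Pi.le_def, Fin.forall_iff_succAbove i,
      Fin.insertNth_apply_same, Fin.insertNth_apply_succAbove, Pi.zero_apply, Pi.one_apply]
    tauto

theorem continuous_insertNth {m : ℕ} (i : Fin (m + 1)) :
    Continuous fun p : ℝ × (Fin m → ℝ) => i.insertNth (α := fun _ => ℝ) p.1 p.2 :=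
  Continuous.finInsertNth (A := fun _ => ℝ) i continuous_fst continuous_snd

theorem setIntegral_carrier_eq {m : ℕ} (c : RefCell) (i : Fin (m + 1)) {f : (Fin (m + 1) → ℝ) → ℝ}
    (hf : Continuous f) :
    ∫ x in c.carrier (m + 1), f x =
      ∫ s in c.carrier m, ∫ y in (0 : ℝ)..c.height s, f (i.insertNth (α := fun _ => ℝ) y s) := by
  have hint : Integrable ((c.carrier (m + 1)).indicator f) :=
    (integrable_indicator_iff (c.measurableSet_carrier _)).2
      (hf.continuousOn.integrableOn_compact (c.isCompact_carrier _))
  have hmp := (volume_preserving_piFinSuccAbove (fun _ : Fin (m + 1) => ℝ) i).symm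
  rw [← integral_indicator (c.measurableSet_carrier _), ← hmp.integral_comp',
    Measure.volume_eq_prod, integral_prod_symm]
  · rw [← integral_indicator (c.measurableSet_carrier _)]
    refine integral_congr_ae (Filter.Eventually.of_forall fun s => ?_)
    simp only [MeasurableEquiv.piFinSuccAbove_symm_apply]
    by_cases hs : s ∈ c.carrier m
    · rw [Set.indicator_of_mem hs, intervalIntegral.integral_of_le (c.height_nonneg hs),
        ← integral_Icc_eq_integral_Ioc, ← integral_indicator measurableSet_Icc]
      refine integral_congr_ae (Filter.Eventually.of_forall fun y => ?_)
      by_cases hy : y ∈ Set.Icc 0 (c.height s)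
      · simp only [Set.indicator_of_mem hy]
        exact Set.indicator_of_mem ((c.insertNth_mem_carrier i y s).2 ⟨hs, hy⟩) f
      · simp only [Set.indicator_of_notMem hy]
        exact Set.indicator_of_notMem (fun h => hy ((c.insertNth_mem_carrier i y s).1 h).2) f
    · rw [Set.indicator_of_notMem hs]
      refine integral_eq_zero_of_ae (Filter.Eventually.of_forall fun y => ?_)
      exact Set.indicator_of_notMem (fun h => hs ((c.insertNth_mem_carrier i y s).1 h).1) f
  · exact hmp.integrable_comp_of_integrable hint

theorem hasDerivAt_insertNth {m : ℕ} (i : Fin (m + 1)) (s : Fin m → ℝ) (y : ℝ) :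
    HasDerivAt (fun y : ℝ => i.insertNth (α := fun _ => ℝ) y s) (Pi.single i 1) y := by
  rw [hasDerivAt_pi]
  intro j
  refine i.succAboveCases ?_ (fun k => ?_) j
  · simpa using hasDerivAt_id' y
  · simpa using hasDerivAt_const y (s k)

theorem setIntegral_carrier_fderiv {m : ℕ} (c : RefCell) (i : Fin (m + 1))
    {f : (Fin (m + 1) → ℝ) → ℝ} (hf : ContDiff ℝ 1 f) :
    ∫ x in c.carrier (m + 1), fderiv ℝ f x (Pi.single i 1) =
      ∫ s in c.carrier m, (f (i.insertNth (α := fun _ => ℝ) (c.height s) s)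
        - f (i.insertNth (α := fun _ => ℝ) 0 s)) := by
  have hc : Continuous fun x => fderiv ℝ f x (Pi.single i 1) :=
    (hf.continuous_fderiv one_ne_zero).clm_apply continuous_const
  rw [setIntegral_carrier_eq c i hc]
  refine setIntegral_congr_fun (c.measurableSet_carrier _) fun s _ => ?_
  refine intervalIntegral.integral_eq_sub_of_hasDerivAt (a := (0 : ℝ)) (b := c.height s)
    (f := fun y => f (i.insertNth (α := fun _ => ℝ) y s))
    (f' := fun y => fderiv ℝ f (i.insertNth (α := fun _ => ℝ) y s) (Pi.single i 1))
    (fun y _ => ?_) ?_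
  · exact (hf.differentiable one_ne_zero _).hasFDerivAt.comp_hasDerivAt y
      (hasDerivAt_insertNth i s y)
  · exact (hc.comp ((continuous_insertNth i).comp
      (continuous_id.prodMk continuous_const))).intervalIntegrable _ _

/-- Integration in direction `i` sees the slanted face as a graph over the other coordinates,
whereas `faceParam` always uses the graph of coordinate `0`. The two parametrizations give the same
integral. -/
theorem setIntegral_simplex_insertNth_height {m : ℕ} (i : Fin (m + 1)) {f : (Fin (m + 1) → ℝ) → ℝ}
    (hf : Continuous f) :
    ∫ s in simplex.carrier m, f (i.insertNth (α := fun _ => ℝ) (1 - ∑ j, s j) s) =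
      ∫ s in simplex.carrier m, f (Fin.cons (1 - ∑ j, s j) s) := by
  have hheight : ∀ n, Continuous fun s : Fin n → ℝ => 1 - ∑ j, s j := fun n =>
    simplex.continuous_height (m := n)
  induction i using Fin.cases with
  | zero => simp only [Fin.insertNth_zero']
  | succ j =>
    obtain ⟨m, rfl⟩ : ∃ m', m = m' + 1 := ⟨m - 1, by have := j.2; omega⟩
    rw [setIntegral_carrier_eq simplex 0, setIntegral_carrier_eq simplex j]
    · refine setIntegral_congr_fun (simplex.measurableSet_carrier _) fun t _ => ?_
      -- With the remaining coordinates `t` fixed, the two free coordinates on the slanted face add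
      -- up to `height t`. The reflection `a ↦ height t - a` exchanges which of them is the
      -- integration variable.
      have h := intervalIntegral.integral_comp_sub_left (a := 0) (b := simplex.height t)
        (fun b => f (Fin.cons (1 - ∑ k, (j.insertNth b t : Fin (m + 1) → ℝ) k)
          (j.insertNth (α := fun _ => ℝ) b t))) (simplex.height t)
      rw [sub_self, sub_zero] at h
      refine Eq.trans ?_ h
      congr 1
      ext a
      congr 1
      have h1 : ∑ k, (Fin.insertNth (α := fun _ => ℝ) 0 a t : Fin (m + 1) → ℝ) k = a + ∑ k, t k := by
        simp [Fin.sum_univ_succ]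
      have h2 : ∑ k, (j.insertNth (α := fun _ => ℝ) (simplex.height t - a) t : Fin (m + 1) → ℝ) k
          = simplex.height t - a + ∑ k, t k := by
        rw [Fin.sum_univ_succAbove _ j]; simp
      rw [h1, h2, Fin.insertNth_zero']
      have h3 : 1 - (simplex.height t - a + ∑ k, t k) = a := by simp only [height]; ring
      have h4 : 1 - (a + ∑ k, t k) = simplex.height t - a := by simp only [height]; ring
      rw [h3, h4]
      exact Fin.insertNth_succ_cons j _ a t
    · exact hf.comp ((hheight _).finCons continuous_id)
    · exact hf.comp ((hheight _).finInsertNth _ continuous_id)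

instance fintypeFace (m : ℕ) (c : RefCell) : Fintype (c.Face m) :=
  match c with
  | .simplex => inferInstanceAs (Fintype (Option (Fin (m + 1))))
  | .cube => inferInstanceAs (Fintype (Fin (m + 1) × Bool))

theorem continuous_faceParam {m : ℕ} (c : RefCell) (f : c.Face m) : Continuous (c.faceParam f) := by
  cases c with
  | simplex =>
    cases f with
    | some i => exact continuous_const.finInsertNth i continuous_id
    | none => exact (simplex.continuous_height).finCons continuous_id
  | cube =>
    obtain ⟨i, b | b⟩ := f
    · exact continuous_const.finInsertNth i continuous_id
    · exact continuous_const.finInsertNth i continuous_id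

theorem faceParam_mem_carrier {m : ℕ} (c : RefCell) (f : c.Face m) {s : Fin m → ℝ}
    (hs : s ∈ c.carrier m) : c.faceParam f s ∈ c.carrier (m + 1) := by
  have h0 := c.height_nonneg hs
  cases c with
  | simplex =>
    cases f with
    | some i => exact (insertNth_mem_carrier _ i _ _).2 ⟨hs, le_rfl, h0⟩
    | none =>
      have := (insertNth_mem_carrier _ 0 (simplex.height s) s).2 ⟨hs, h0, le_rfl⟩
      rwa [Fin.insertNth_zero'] at this
  | cube =>
    obtain ⟨i, b | b⟩ := f
    · exact (insertNth_mem_carrier _ i _ _).2 ⟨hs, le_rfl, h0⟩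
    · exact (insertNth_mem_carrier _ i _ _).2 ⟨hs, h0, le_rfl⟩

/-- The divergence theorem on a reference cell. -/
theorem setIntegral_divergence {m : ℕ} (c : RefCell) {g : Fin (m + 1) → (Fin (m + 1) → ℝ) → ℝ}
    (hg : ∀ i, ContDiff ℝ 1 (g i)) :
    ∫ x in c.carrier (m + 1), ∑ i, fderiv ℝ (g i) x (Pi.single i 1) =
      ∑ f : c.Face m, ∫ s in c.carrier m, ∑ i, c.faceNormal f i * g i (c.faceParam f s) := by
  have hint : ∀ {φ : (Fin m → ℝ) → ℝ}, Continuous φ → IntegrableOn φ (c.carrier m) := fun h =>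
    h.continuousOn.integrableOn_compact (c.isCompact_carrier _)
  have h0 : ∀ i, Continuous fun s : Fin m → ℝ => g i (i.insertNth (α := fun _ => ℝ) 0 s) :=
    fun i => (hg i).continuous.comp (continuous_const.finInsertNth i continuous_id)
  have h1 : ∀ i, Continuous fun s : Fin m → ℝ =>
      g i (i.insertNth (α := fun _ => ℝ) (c.height s) s) :=
    fun i => (hg i).continuous.comp (c.continuous_height.finInsertNth i continuous_id)
  have hL : ∫ x in c.carrier (m + 1), ∑ i, fderiv ℝ (g i) x (Pi.single i 1) =
      ∑ i, ((∫ s in c.carrier m, g i (i.insertNth (α := fun _ => ℝ) (c.height s) s))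
        - ∫ s in c.carrier m, g i (i.insertNth (α := fun _ => ℝ) 0 s)) := by
    rw [integral_finsetSum]
    · refine Finset.sum_congr rfl fun i _ => ?_
      rw [setIntegral_carrier_fderiv c i (hg i), integral_sub (hint (h1 i)) (hint (h0 i))]
    · intro i _
      exact (((hg i).continuous_fderiv one_ne_zero).clm_apply
        continuous_const).continuousOn.integrableOn_compact (c.isCompact_carrier _)
  rw [hL]
  cases c with
  | simplex =>
    change _ = ∑ f : Option (Fin (m + 1)), _
    rw [Fintype.sum_option, Finset.sum_sub_distrib, sub_eq_add_neg, ← Finset.sum_neg_distrib]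
    congr 1
    · simp only [faceNormal, Pi.one_apply, one_mul, faceParam]
      rw [integral_finsetSum]
      · exact Finset.sum_congr rfl fun i _ =>
          setIntegral_simplex_insertNth_height i (hg i).continuous
      · exact fun i _ => hint ((hg i).continuous.comp
          (simplex.continuous_height.finCons continuous_id))
    · refine Finset.sum_congr rfl fun i _ => ?_
      simp only [faceNormal, faceParam, Pi.neg_apply, Pi.single_apply]
      rw [← integral_neg]
      congr 1
      ext s
      simp
  | cube =>
    change _ = ∑ f : Fin (m + 1) × Bool, _
    rw [Fintype.sum_prod_type]
    refine Finset.sum_congr rfl fun i _ => ?_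
    rw [Fintype.sum_bool, sub_eq_add_neg, ← integral_neg]
    congr 1
    · congr 1
      ext s
      simp [faceNormal, faceParam, Pi.single_apply, height]
    · congr 1
      ext s
      simp [faceNormal, faceParam, Pi.single_apply]

end RefCell

/-! ### The Piola identity and the divergence theorem on one curved cell. -/

section Piola

theorem jacobian_apply {n : ℕ} (T : (Fin n → ℝ) → (Fin n → ℝ)) (x : Fin n → ℝ) (a b : Fin n) :
    jacobian T x a b = fderiv ℝ T x (Pi.single b 1) a := by
  simp [jacobian, LinearMap.toMatrix'_apply]

variable {n : ℕ} {T : (Fin n → ℝ) → (Fin n → ℝ)}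

theorem contDiff_jacobian (hT : ContDiff ℝ 2 T) (a b : Fin n) :
    ContDiff ℝ 1 fun x => jacobian T x a b := by
  simp only [jacobian_apply]
  exact contDiff_pi.1 ((hT.fderiv_right (m := 1) (by norm_num)).clm_apply contDiff_const) a

theorem contDiff_matrix_det {A : (Fin n → ℝ) → Matrix (Fin n) (Fin n) ℝ}
    (hA : ∀ a b, ContDiff ℝ 1 fun x => A x a b) : ContDiff ℝ 1 fun x => (A x).det := by
  simp only [Matrix.det_apply]
  exact ContDiff.sum fun σ _ => (contDiff_prod fun i _ => hA _ _).const_smul _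

theorem contDiff_adjugate_jacobian (hT : ContDiff ℝ 2 T) (a b : Fin n) :
    ContDiff ℝ 1 fun x => (jacobian T x).adjugate a b := by
  simp only [Matrix.adjugate_apply]
  refine contDiff_matrix_det fun i j => ?_
  simp only [Matrix.updateRow_apply]
  split_ifs
  · exact contDiff_const
  · exact contDiff_jacobian hT i j

theorem fderiv_jacobian_comm (hT : ContDiff ℝ 2 T) (x : Fin n → ℝ) (a b c : Fin n) :
    fderiv ℝ (fun x => jacobian T x a b) x (Pi.single c 1) =
      fderiv ℝ (fun x => jacobian T x a c) x (Pi.single b 1) := by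
  have hd : DifferentiableAt ℝ (fderiv ℝ T) x :=
    (hT.fderiv_right (m := 1) (by norm_num)).differentiable one_ne_zero x
  have h : ∀ b c : Fin n, fderiv ℝ (fun x => jacobian T x a b) x (Pi.single c 1) =
      fderiv ℝ (fderiv ℝ T) x (Pi.single c 1) (Pi.single b 1) a := fun b c => by
    simp only [jacobian_apply]
    have h1 := (hd.hasFDerivAt.clm_apply (hasFDerivAt_const (Pi.single b (1 : ℝ)) x))
    rw [(hasFDerivAt_pi'.1 h1 a).fderiv]
    simp
  rw [h, h, (hT.contDiffAt.isSymmSndFDerivAt (by simp)).eq]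

/-- The Piola identity. -/
theorem sum_fderiv_adjugate_jacobian (hn : n ≤ 3) (hT : ContDiff ℝ 2 T) (x : Fin n → ℝ)
    (j : Fin n) :
    ∑ i, fderiv ℝ (fun x => (jacobian T x).adjugate i j) x (Pi.single i 1) = 0 := by
  have hd : ∀ a b, DifferentiableAt ℝ (fun x => jacobian T x a b) x := fun a b =>
    (contDiff_jacobian hT a b).differentiable one_ne_zero x
  have hc := fderiv_jacobian_comm hT x
  -- In dimension at most three the cofactors are explicit, and the second derivatives of `T` cancel
  -- in pairs by symmetry.
  obtain rfl | rfl | rfl | rfl : n = 0 ∨ n = 1 ∨ n = 2 ∨ n = 3 := by omega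
  · exact j.elim0
  · simp
  · simp only [Matrix.adjugate_fin_two, Fin.sum_univ_two]
    fin_cases j
    · simp [hc 1 0 1]
    · simp [hc 0 0 1]
  · simp only [Matrix.adjugate_fin_three, Fin.sum_univ_three]
    fin_cases j
    · simp (disch := fun_prop) [fderiv_fun_sub, fderiv_fun_add, fderiv_fun_mul]
      rw [hc 1 1 0, hc 1 2 0, hc 2 1 0, hc 2 2 0, hc 1 2 1, hc 2 2 1]
      ring
    · simp (disch := fun_prop) [fderiv_fun_sub, fderiv_fun_add, fderiv_fun_mul]
      rw [hc 0 1 0, hc 0 2 0, hc 2 1 0, hc 2 2 0, hc 0 2 1, hc 2 2 1]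
      ring
    · simp (disch := fun_prop) [fderiv_fun_sub, fderiv_fun_add, fderiv_fun_mul]
      rw [hc 0 1 0, hc 0 2 0, hc 1 1 0, hc 1 2 0, hc 0 2 1, hc 1 2 1]
      ring

/-- The divergence theorem on a curved cell, pulled back to the reference cell. -/
theorem setIntegral_fderiv_mul_adjugate {m : ℕ} (hm : m + 1 ≤ 3) (c : RefCell)
    {T : (Fin (m + 1) → ℝ) → (Fin (m + 1) → ℝ)} (hT : ContDiff ℝ 2 T)
    {W : (Fin (m + 1) → ℝ) → ℝ} (hW : ContDiff ℝ 1 W) (j : Fin (m + 1)) :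
    ∫ x in c.carrier (m + 1),
        ∑ i, fderiv ℝ W x (Pi.single i 1) * (jacobian T x).adjugate i j =
      ∑ f : c.Face m, ∫ s in c.carrier m, W (c.faceParam f s) * areaVector T c f s j := by
  have hadj := fun i => contDiff_adjugate_jacobian hT i j
  have h := c.setIntegral_divergence (g := fun i x => W x * (jacobian T x).adjugate i j)
    fun i => hW.mul (hadj i)
  -- By the product rule and the Piola identity, no derivative of the cofactors survives.
  have h1 : ∀ x, ∑ i, fderiv ℝ (fun x => W x * (jacobian T x).adjugate i j) x (Pi.single i 1) =
      ∑ i, fderiv ℝ W x (Pi.single i 1) * (jacobian T x).adjugate i j := fun x => by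
    have : ∀ i, fderiv ℝ (fun x => W x * (jacobian T x).adjugate i j) x (Pi.single i 1) =
        W x * fderiv ℝ (fun x => (jacobian T x).adjugate i j) x (Pi.single i 1) +
          fderiv ℝ W x (Pi.single i 1) * (jacobian T x).adjugate i j := fun i => by
      rw [fderiv_fun_mul (hW.differentiable one_ne_zero x) ((hadj i).differentiable one_ne_zero x)]
      simp [mul_comm]
    simp only [this, Finset.sum_add_distrib, ← Finset.mul_sum,
      sum_fderiv_adjugate_jacobian hm hT, mul_zero, zero_add]
  simp only [h1] at h
  rw [h]
  refine Finset.sum_congr rfl fun f _ => ?_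
  congr 1
  ext s
  rw [areaVector, Matrix.mulVec, dotProduct, Finset.mul_sum]
  exact Finset.sum_congr rfl fun i _ => by rw [Matrix.transpose_apply]; ring

end Piola

/-- The tangent vectors of the parametrization of a reference face. -/
noncomputable def RefCell.faceTangent {m : ℕ} :
    (c : RefCell) → c.Face m → Fin m → (Fin (m + 1) → ℝ)
  | .simplex, some i, k => Pi.single (i.succAbove k) 1
  | .simplex, none, k => Pi.single k.succ 1 - Pi.single 0 1
  | .cube, (i, _), k => Pi.single (i.succAbove k) 1

/-! ### Tangents and normals of the reference faces. -/

namespace RefCell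

variable {m : ℕ}

theorem insertNth_eq_add_sum (i : Fin (m + 1)) (y : ℝ) (s : Fin m → ℝ) :
    i.insertNth (α := fun _ => ℝ) y s = i.insertNth (α := fun _ => ℝ) y (0 : Fin m → ℝ)
      + ∑ k, s k • (Pi.single (i.succAbove k) 1 : Fin (m + 1) → ℝ) := by
  ext j
  refine i.succAboveCases ?_ (fun l => ?_) j
  · simp [Finset.sum_apply, (Fin.succAbove_ne i _).symm]
  · simp [Finset.sum_apply, Pi.single_apply]

theorem faceParam_eq_add_sum (c : RefCell) (f : c.Face m) (s : Fin m → ℝ) :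
    c.faceParam f s = c.faceParam f 0 + ∑ k, s k • c.faceTangent f k := by
  cases c with
  | simplex =>
    cases f with
    | some i => exact insertNth_eq_add_sum i 0 s
    | none =>
      simp only [faceParam, faceTangent]
      ext j
      refine Fin.cases ?_ (fun l => ?_) j
      · simp [Finset.sum_apply, (Fin.succ_ne_zero _).symm, sub_eq_add_neg]
      · simp [Finset.sum_apply, Pi.single_apply]
  | cube =>
    obtain ⟨i, b | b⟩ := f
    · exact insertNth_eq_add_sum i 0 s
    · exact insertNth_eq_add_sum i 1 s

theorem hasFDerivAt_faceParam (c : RefCell) (f : c.Face m) (s : Fin m → ℝ) :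
    HasFDerivAt (c.faceParam f)
      (LinearMap.toContinuousLinearMap (Fintype.linearCombination ℝ (c.faceTangent f))) s := by
  have : c.faceParam f = fun s => c.faceParam f 0 +
      LinearMap.toContinuousLinearMap (Fintype.linearCombination ℝ (c.faceTangent f)) s := by
    ext1 s
    rw [faceParam_eq_add_sum]
    rfl
  rw [this]
  exact (ContinuousLinearMap.hasFDerivAt _).const_add _

theorem det_cons_single_succAbove (i : Fin (m + 1)) (v : Fin (m + 1) → ℝ) :
    (Matrix.of (Fin.cons v fun k => Pi.single (i.succAbove k) 1 :
      Fin (m + 1) → Fin (m + 1) → ℝ)).det = (-1) ^ (i : ℕ) * v i := by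
  rw [Matrix.det_succ_row_zero, Finset.sum_eq_single i]
  · have : (Matrix.of (Fin.cons v fun k => Pi.single (i.succAbove k) 1 :
        Fin (m + 1) → Fin (m + 1) → ℝ)).submatrix Fin.succ i.succAbove = 1 := by
      ext k l
      simp [Matrix.one_apply, Pi.single_apply, eq_comm]
    rw [this, Matrix.det_one]
    simp
  · intro j _ hj
    obtain ⟨l, hl⟩ := Fin.exists_succAbove_eq hj.symm
    rw [Matrix.det_eq_zero_of_column_eq_zero l, mul_zero]
    intro k
    simp [hl, (Fin.succAbove_ne i k).symm]
  · simp

theorem det_cons_single_sub (hm : m + 1 ≤ 3) (v : Fin (m + 1) → ℝ) :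
    (Matrix.of (Fin.cons v fun k => Pi.single k.succ 1 - Pi.single 0 1 :
      Fin (m + 1) → Fin (m + 1) → ℝ)).det = ∑ i, v i := by
  obtain rfl | rfl | rfl : m = 0 ∨ m = 1 ∨ m = 2 := by omega
  · simp
  · simp [Matrix.det_fin_two, Fin.sum_univ_two]
  · have h2 : (Fin.cons v fun k => Pi.single k.succ 1 - Pi.single 0 1 :
        Fin 3 → Fin 3 → ℝ) 2 = Pi.single 2 1 - Pi.single 0 1 := rfl
    simp [Matrix.det_fin_three, Fin.sum_univ_three, h2]

/-- The normal vector of a reference face is, up to the sign, the cross product of its tangent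
vectors. -/
theorem exists_faceNormal_dotProduct_eq (hm : m + 1 ≤ 3) (c : RefCell) (f : c.Face m) :
    ∃ σ : ℝ, |σ| = 1 ∧ ∀ v, c.faceNormal f ⬝ᵥ v =
      σ * (Matrix.of (Fin.cons v (c.faceTangent f) : Fin (m + 1) → Fin (m + 1) → ℝ)).det := by
  have hs : ∀ n : ℕ, (-1 : ℝ) ^ n * (-1) ^ n = 1 := fun n => by
    rw [← mul_pow]; simp
  cases c with
  | simplex =>
    cases f with
    | some i =>
      refine ⟨-(-1) ^ (i : ℕ), by simp, fun v => ?_⟩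
      have : Matrix.of (Fin.cons v (simplex.faceTangent (some i)) : Fin (m + 1) → Fin (m + 1) → ℝ)
        = Matrix.of (Fin.cons v fun k => Pi.single (i.succAbove k) 1 :
          Fin (m + 1) → Fin (m + 1) → ℝ) := rfl
      rw [this, det_cons_single_succAbove, ← mul_assoc, neg_mul, hs]
      simp [faceNormal]
    | none =>
      refine ⟨1, by simp, fun v => ?_⟩
      have : Matrix.of (Fin.cons v (simplex.faceTangent none) : Fin (m + 1) → Fin (m + 1) → ℝ)
        = Matrix.of (Fin.cons v fun k => Pi.single k.succ 1 - Pi.single 0 1 :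
          Fin (m + 1) → Fin (m + 1) → ℝ) := rfl
      rw [this, det_cons_single_sub hm]
      simp [faceNormal, dotProduct]
  | cube =>
    obtain ⟨i, b⟩ := f
    have : ∀ v, Matrix.of (Fin.cons v (cube.faceTangent (i, b)) : Fin (m + 1) → Fin (m + 1) → ℝ)
        = Matrix.of (Fin.cons v fun k => Pi.single (i.succAbove k) 1 :
          Fin (m + 1) → Fin (m + 1) → ℝ) := fun _ => rfl
    cases b
    · refine ⟨-(-1) ^ (i : ℕ), by simp, fun v => ?_⟩
      rw [this, det_cons_single_succAbove, ← mul_assoc, neg_mul, hs]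
      simp [faceNormal]
    · refine ⟨(-1) ^ (i : ℕ), by simp, fun v => ?_⟩
      rw [this, det_cons_single_succAbove, ← mul_assoc, hs]
      simp [faceNormal]

theorem faceNormal_ne_zero (c : RefCell) (f : c.Face m) : c.faceNormal f ≠ 0 := by
  cases c with
  | simplex =>
    cases f with
    | some i => simp [faceNormal]
    | none => simp [faceNormal]
  | cube => obtain ⟨i, b | b⟩ := f <;> simp [faceNormal]

end RefCell

/-! ### Area vectors of curved faces and their change under reparametrization. -/

section Face

variable {m : ℕ} {T : (Fin (m + 1) → ℝ) → (Fin (m + 1) → ℝ)} {c : RefCell} {f : c.Face m}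

theorem jacobian_mulVec (x v : Fin (m + 1) → ℝ) : jacobian T x *ᵥ v = fderiv ℝ T x v := by
  rw [jacobian, ← Matrix.toLin'_apply, Matrix.toLin'_toMatrix']
  rfl

/-- Nanson's formula against the cross product of the physical tangents: the rows `w, DT t_k` are
the rows `J⁻¹w, t_k` multiplied by `Jᵀ`, and `det J · J⁻¹` is the adjugate. The sign depends on the
reference face alone. -/
theorem exists_areaVector_dotProduct_eq (hm : m + 1 ≤ 3) (c : RefCell) (f : c.Face m) :
    ∃ σ : ℝ, |σ| = 1 ∧ ∀ (T : (Fin (m + 1) → ℝ) → (Fin (m + 1) → ℝ)) (s : Fin m → ℝ),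
      (jacobian T (c.faceParam f s)).det ≠ 0 → ∀ w, areaVector T c f s ⬝ᵥ w =
      σ * (Matrix.of (Fin.cons w fun k => fderiv ℝ T (c.faceParam f s) (c.faceTangent f k) :
        Fin (m + 1) → Fin (m + 1) → ℝ)).det := by
  obtain ⟨σ, hσ, h⟩ := c.exists_faceNormal_dotProduct_eq hm f
  refine ⟨σ, hσ, fun T s hdet w => ?_⟩
  set J := jacobian T (c.faceParam f s) with hJ
  have h1 : (Matrix.of (Fin.cons w fun k => fderiv ℝ T (c.faceParam f s) (c.faceTangent f k) :
      Fin (m + 1) → Fin (m + 1) → ℝ)) = Matrix.of (Fin.cons (J⁻¹ *ᵥ w) (c.faceTangent f) :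
      Fin (m + 1) → Fin (m + 1) → ℝ) * Jᵀ := by
    ext a b
    refine Fin.cases ?_ (fun k => ?_) a
    · rw [Matrix.mul_apply_eq_vecMul]
      change w b = ((J⁻¹ *ᵥ w) ᵥ* Jᵀ) b
      rw [Matrix.vecMul_transpose, Matrix.mulVec_mulVec,
        Matrix.mul_nonsing_inv _ (isUnit_iff_ne_zero.2 hdet), Matrix.one_mulVec]
    · rw [Matrix.mul_apply_eq_vecMul]
      change fderiv ℝ T (c.faceParam f s) (c.faceTangent f k) b = (c.faceTangent f k ᵥ* Jᵀ) b
      rw [Matrix.vecMul_transpose, hJ, jacobian_mulVec]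
  rw [h1, Matrix.det_mul, Matrix.det_transpose, mul_comm _ J.det, mul_left_comm, ← h, areaVector,
    ← hJ, Matrix.mulVec_transpose, ← Matrix.dotProduct_mulVec, ← smul_eq_mul, ← dotProduct_smul,
    ← Matrix.smul_mulVec, Matrix.inv_def, smul_smul, Ring.inverse_eq_inv', mul_inv_cancel₀ hdet,
    one_smul]

theorem det_cons_sum (w : Fin (m + 1) → ℝ) (t : Fin m → Fin (m + 1) → ℝ)
    (A : Matrix (Fin m) (Fin m) ℝ) :
    (Matrix.of (Fin.cons w fun k => ∑ l, A l k • t l : Fin (m + 1) → Fin (m + 1) → ℝ)).det =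
      A.det * (Matrix.of (Fin.cons w t : Fin (m + 1) → Fin (m + 1) → ℝ)).det := by
  -- The block diagonal matrix of `1` and `Aᵀ`: it fixes the row `w` and recombines the tangents.
  set B : Matrix (Fin (m + 1)) (Fin (m + 1)) ℝ :=
    Matrix.of (Fin.cons (Pi.single 0 1) fun k => Fin.cons 0 fun l => A l k) with hB
  have h1 : B.det = A.det := by
    rw [Matrix.det_succ_row_zero, Fin.sum_univ_succ, Finset.sum_eq_zero, add_zero]
    · have : B.submatrix Fin.succ (Fin.succAbove 0) = Aᵀ := by
        ext k l
        simp [hB]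
      rw [this, Matrix.det_transpose]
      simp [hB]
    · intro k _
      simp [hB]
  rw [← h1, ← Matrix.det_mul]
  congr 1
  ext a b
  refine Fin.cases ?_ (fun k => ?_) a
  · simp [hB, Matrix.mul_apply, Fin.sum_univ_succ]
  · simp [hB, Matrix.mul_apply, Fin.sum_univ_succ, Finset.sum_apply]

/-- Multiplication by `Jᵀ` turns the area vector into `det J` times the reference normal, which is
not zero. -/
theorem areaVector_ne_zero {s : Fin m → ℝ} (h : (jacobian T (c.faceParam f s)).det ≠ 0) :
    areaVector T c f s ≠ 0 := by
  intro h0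
  apply c.faceNormal_ne_zero f
  have h1 : (jacobian T (c.faceParam f s))ᵀ *ᵥ areaVector T c f s =
      (jacobian T (c.faceParam f s)).det • c.faceNormal f := by
    rw [areaVector, Matrix.mulVec_mulVec, ← Matrix.transpose_mul, Matrix.adjugate_mul,
      Matrix.transpose_smul, Matrix.transpose_one, Matrix.smul_mulVec, Matrix.one_mulVec]
  rw [h0, Matrix.mulVec_zero] at h1
  exact (smul_eq_zero.1 h1.symm).resolve_left h

theorem areaDensity_pos {s : Fin m → ℝ} (h : (jacobian T (c.faceParam f s)).det ≠ 0) :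
    0 < areaDensity T c f s := by
  refine Real.sqrt_pos.2 (lt_of_le_of_ne (Finset.sum_nonneg fun i _ => mul_self_nonneg _) ?_)
  exact fun h0 => areaVector_ne_zero h (dotProduct_self_eq_zero.1 h0.symm)

theorem areaDensity_smul_unitNormal {s : Fin m → ℝ}
    (h : (jacobian T (c.faceParam f s)).det ≠ 0) :
    areaDensity T c f s • unitNormal T c f s = areaVector T c f s := by
  rw [unitNormal, smul_smul, mul_inv_cancel₀ (areaDensity_pos h).ne', one_smul]

theorem continuous_areaVector (hT : ContDiff ℝ 2 T) : Continuous (areaVector T c f) := by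
  refine Continuous.matrix_mulVec ?_ continuous_const
  refine continuous_matrix fun i j => ?_
  exact (contDiff_adjugate_jacobian hT j i).continuous.comp (c.continuous_faceParam f)

theorem continuous_areaDensity (hT : ContDiff ℝ 2 T) : Continuous (areaDensity T c f) :=
  ((continuous_areaVector hT).dotProduct (continuous_areaVector hT)).sqrt

theorem continuousOn_unitNormal (hT : ContDiff ℝ 2 T)
    (h : ∀ x ∈ c.carrier (m + 1), 0 < (jacobian T x).det) :
    ContinuousOn (unitNormal T c f) (c.carrier m) :=
  ((continuous_areaDensity hT).continuousOn.inv₀ fun _ hs =>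
    (areaDensity_pos (h _ (c.faceParam_mem_carrier f hs)).ne').ne').smul
    (continuous_areaVector hT).continuousOn

/-- Two parametrizations of a surface have the same surface measure. -/
theorem areaDensity_eq_of_eqOn (hm : m + 1 ≤ 3) {T' : (Fin (m + 1) → ℝ) → (Fin (m + 1) → ℝ)}
    {c' : RefCell} {f' : c'.Face m} (hT : ContDiff ℝ 2 T) (hT' : ContDiff ℝ 2 T')
    {π : (Fin m → ℝ) → (Fin m → ℝ)} (hπ : DifferentiableOn ℝ π (c.carrier m))
    (heq : ∀ s ∈ c.carrier m, curvedFace T' c' f' (π s) = curvedFace T c f s)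
    {s : Fin m → ℝ} (hs : s ∈ c.carrier m) (hd : (jacobian T (c.faceParam f s)).det ≠ 0)
    (hd' : (jacobian T' (c'.faceParam f' (π s))).det ≠ 0) :
    areaDensity T c f s =
      |(fderivWithin ℝ π (c.carrier m) s).det| * areaDensity T' c' f' (π s) := by
  set π' := fderivWithin ℝ π (c.carrier m) s with hπ'
  set A : Matrix (Fin m) (Fin m) ℝ := LinearMap.toMatrix' π'.toLinearMap with hA
  have hdetA : A.det = π'.det := LinearMap.det_toMatrix' _
  have hγ := (hT.differentiable two_ne_zero (c.faceParam f s)).hasFDerivAt.comp s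
    (c.hasFDerivAt_faceParam f s) |>.hasFDerivWithinAt (s := c.carrier m)
  have hγ' := ((hT'.differentiable two_ne_zero (c'.faceParam f' (π s))).hasFDerivAt.comp (π s)
    (c'.hasFDerivAt_faceParam f' (π s))).comp_hasFDerivWithinAt s (hπ s hs).hasFDerivWithinAt
  -- Two derivatives of one map on the carrier: the left parametrization, and the right one composed
  -- with `π`. Equating them expresses the left tangents through the right ones, with matrix `Dπ`.
  have huniq := (c.uniqueDiffOn_carrier m s hs).eq hγ
    (hγ'.congr (fun y hy => (heq y hy).symm) (heq s hs).symm)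
  have htan : ∀ k, fderiv ℝ T (c.faceParam f s) (c.faceTangent f k) =
      ∑ l, A l k • fderiv ℝ T' (c'.faceParam f' (π s)) (c'.faceTangent f' l) := fun k => by
    have h1 := congrArg (fun L => L (Pi.single k 1)) huniq
    simp only [ContinuousLinearMap.comp_apply, LinearMap.coe_toContinuousLinearMap',
      Fintype.linearCombination_apply_single, one_smul] at h1
    rw [h1, Fintype.linearCombination_apply, map_sum]
    refine Finset.sum_congr rfl fun l _ => ?_
    rw [map_smul, hA, LinearMap.toMatrix'_apply]
    rfl
  obtain ⟨σ, hσ, h⟩ := exists_areaVector_dotProduct_eq hm c f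
  obtain ⟨σ', hσ', h'⟩ := exists_areaVector_dotProduct_eq hm c' f'
  have hσσ : σ' * σ' = 1 := by rw [← abs_mul_abs_self, hσ', one_mul]
  -- The signs `σ`, `σ'` and the sign of `det A` disappear in the length. No orientation argument is
  -- needed, as the direction of the normals is part of the gluing condition.
  have hvec : areaVector T c f s = (σ * A.det * σ') • areaVector T' c' f' (π s) := by
    refine dotProduct_eq _ _ fun w => ?_
    rw [h T s hd, smul_dotProduct, h' T' (π s) hd', smul_eq_mul]
    simp only [htan]
    rw [det_cons_sum]
    linear_combination (-σ * A.det * (Matrix.of (Fin.cons w fun k =>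
      fderiv ℝ T' (c'.faceParam f' (π s)) (c'.faceTangent f' k) :
        Fin (m + 1) → Fin (m + 1) → ℝ)).det) * hσσ
  rw [areaDensity, hvec, smul_dotProduct, dotProduct_smul, smul_smul, smul_eq_mul,
    Real.sqrt_mul (mul_self_nonneg _), Real.sqrt_mul_self_eq_abs, abs_mul, abs_mul, hσ, hσ',
    one_mul, mul_one, hdetA, areaDensity]

end Face

/-! ### Derivatives and zeros of polynomials on the reference cells. -/

section Polynomial

variable {n : ℕ}

theorem contDiff_eval (p : MvPolynomial (Fin n) ℝ) :
    ContDiff ℝ 1 fun x : Fin n → ℝ => MvPolynomial.eval x p :=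
  (AnalyticOnNhd.eval_mvPolynomial p).contDiff

theorem hasFDerivAt_eval (p : MvPolynomial (Fin n) ℝ) (x : Fin n → ℝ) :
    HasFDerivAt (fun x : Fin n → ℝ => MvPolynomial.eval x p)
      (∑ i, MvPolynomial.eval x (MvPolynomial.pderiv i p) •
        (ContinuousLinearMap.proj i : (Fin n → ℝ) →L[ℝ] ℝ)) x := by
  induction p using MvPolynomial.induction_on with
  | C a => simpa using hasFDerivAt_const a x
  | add p q hp hq =>
    simpa [add_smul, Finset.sum_add_distrib] using hp.fun_add hq
  | mul_X p j hp =>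
    have h := hp.fun_mul (hasFDerivAt_apply (𝕜 := ℝ) j x)
    have heq : ∑ i, MvPolynomial.eval x (MvPolynomial.pderiv i (p * MvPolynomial.X j)) •
        (ContinuousLinearMap.proj i : (Fin n → ℝ) →L[ℝ] ℝ) =
        MvPolynomial.eval x p • ContinuousLinearMap.proj j +
        x j • ∑ i, MvPolynomial.eval x (MvPolynomial.pderiv i p) •
        (ContinuousLinearMap.proj i : (Fin n → ℝ) →L[ℝ] ℝ) := by
      simp only [MvPolynomial.pderiv_mul, MvPolynomial.pderiv_X, map_add, map_mul,
        MvPolynomial.eval_X, add_smul, Finset.sum_add_distrib, Finset.smul_sum, smul_smul]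
      rw [add_comm]
      congr 1
      · rw [Finset.sum_eq_single j]
        · simp
        · intro i _ hi
          simp [hi.symm]
        · simp
      · exact Finset.sum_congr rfl fun i _ => by rw [mul_comm]
    rw [heq]
    simpa only [map_mul, MvPolynomial.eval_X] using h

theorem fderiv_eval_apply (p : MvPolynomial (Fin n) ℝ) (x v : Fin n → ℝ) :
    fderiv ℝ (fun x : Fin n → ℝ => MvPolynomial.eval x p) x v =
      ∑ i, MvPolynomial.eval x (MvPolynomial.pderiv i p) * v i := by
  rw [(hasFDerivAt_eval p x).fderiv]
  simp

theorem fderiv_eval_single (p : MvPolynomial (Fin n) ℝ) (x : Fin n → ℝ) (i : Fin n) :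
    fderiv ℝ (fun x : Fin n → ℝ => MvPolynomial.eval x p) x (Pi.single i 1) =
      MvPolynomial.eval x (MvPolynomial.pderiv i p) := by
  rw [fderiv_eval_apply, Finset.sum_eq_single i]
  · simp
  · intro j _ hj
    simp [hj]
  · simp

/-- A polynomial that vanishes almost everywhere on a reference cell is zero. -/
theorem eq_zero_of_ae_eval_eq_zero (c : RefCell) {p : MvPolynomial (Fin n) ℝ}
    (h : ∀ᵐ x ∂volume.restrict (c.carrier n), MvPolynomial.eval x p = 0) : p = 0 := by
  refine MvPolynomial.funext_set (fun _ => Set.Ioo (0 : ℝ) (1 / (n + 1 : ℝ)))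
    (fun _ => Set.Ioo_infinite (by positivity)) fun x hx => ?_
  have h1 : (fun x => MvPolynomial.eval x p) =ᵐ[volume.restrict (RefCell.box n)] fun _ => 0 :=
    ae_restrict_of_ae_restrict_of_subset (c.box_subset_carrier n) h
  have := Measure.eqOn_open_of_ae_eq h1 (RefCell.isOpen_box n)
    (contDiff_eval p).continuous.continuousOn continuousOn_const hx
  simpa using this

end Polynomial

/-! ### Pulling cell integrals back to the reference cells. -/

namespace CurvedMesh

variable {m : ℕ} {K I B : Type} (M : CurvedMesh m K I B)

/-- The inverse of the reference-to-physical map of a cell. -/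
noncomputable def pull (k : K) (x : Fin (m + 1) → ℝ) : Fin (m + 1) → ℝ :=
  Function.invFunOn (M.map k) ((M.shape k).carrier (m + 1)) x

theorem pull_map (k : K) {x : Fin (m + 1) → ℝ} (hx : x ∈ (M.shape k).carrier (m + 1)) :
    M.pull k (M.map k x) = x :=
  (M.inj k).leftInvOn_invFunOn hx

/-- A continuous injection of a compact set is a homeomorphism onto its image. -/
theorem continuousOn_pull (k : K) : ContinuousOn (M.pull k) (M.cell k) := by
  rw [continuousOn_iff_isClosed]
  intro t ht
  refine ⟨M.map k '' ((M.shape k).carrier (m + 1) ∩ t), ?_, ?_⟩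
  · exact ((((M.shape k).isCompact_carrier _).inter_right ht).image
      (M.smooth k).continuous).isClosed
  · ext y
    constructor
    · rintro ⟨hy, x, hx, rfl⟩
      refine ⟨⟨x, ⟨hx, ?_⟩, rfl⟩, x, hx, rfl⟩
      simpa [M.pull_map k hx] using hy
    · rintro ⟨⟨x, ⟨hx, hxt⟩, rfl⟩, -⟩
      exact ⟨by simpa [M.pull_map k hx] using hxt, x, hx, rfl⟩

theorem det_fderiv_map (k : K) (x : Fin (m + 1) → ℝ) :
    (fderiv ℝ (M.map k) x).det = (jacobian (M.map k) x).det :=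
  (LinearMap.det_toMatrix' _).symm

theorem hasFDerivAt_map (k : K) (x : Fin (m + 1) → ℝ) :
    HasFDerivAt (M.map k) (fderiv ℝ (M.map k) x) x :=
  ((M.smooth k).differentiable two_ne_zero x).hasFDerivAt

theorem continuous_det (k : K) : Continuous fun x => (jacobian (M.map k) x).det :=
  (contDiff_matrix_det (contDiff_jacobian (M.smooth k))).continuous

theorem setIntegral_cell (k : K) (g : (Fin (m + 1) → ℝ) → ℝ) :
    ∫ x in M.cell k, g x =
      ∫ x in (M.shape k).carrier (m + 1), (jacobian (M.map k) x).det * g (M.map k x) := by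
  rw [cell, integral_image_eq_integral_abs_det_fderiv_smul volume
    ((M.shape k).measurableSet_carrier _) (fun x _ => (M.hasFDerivAt_map k x).hasFDerivWithinAt)
    (M.inj k)]
  refine setIntegral_congr_fun ((M.shape k).measurableSet_carrier _) fun x hx => ?_
  simp only [det_fderiv_map, abs_of_pos (M.det_pos k x hx), smul_eq_mul]

theorem integrableOn_carrier_of_cell (k : K) {g : (Fin (m + 1) → ℝ) → ℝ}
    (hg : IntegrableOn g (M.cell k)) :
    IntegrableOn (fun x => (jacobian (M.map k) x).det * g (M.map k x))
      ((M.shape k).carrier (m + 1)) := by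
  rw [cell, integrableOn_image_iff_integrableOn_abs_det_fderiv_smul volume
    ((M.shape k).measurableSet_carrier _) (fun x _ => (M.hasFDerivAt_map k x).hasFDerivWithinAt)
    (M.inj k)] at hg
  refine hg.congr_fun (fun x hx => ?_) ((M.shape k).measurableSet_carrier _)
  simp only [det_fderiv_map, abs_of_pos (M.det_pos k x hx), smul_eq_mul]

/-- Preimages of null sets are null because the Jacobian determinant does not vanish on the cell. -/
theorem ae_carrier_of_ae_cell (k : K) {p : (Fin (m + 1) → ℝ) → Prop}
    (h : ∀ᵐ x ∂volume.restrict (M.cell k), p x) :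
    ∀ᵐ x ∂volume.restrict ((M.shape k).carrier (m + 1)), p (M.map k x) := by
  rw [cell, ← map_withDensity_abs_det_fderiv_eq_addHaar volume
    ((M.shape k).measurableSet_carrier _).nullMeasurableSet
    (fun x _ => (M.hasFDerivAt_map k x).hasFDerivWithinAt) (M.inj k)] at h
  have h1 := ae_of_ae_map (M.smooth k).continuous.measurable.aemeasurable h
  simp only [det_fderiv_map] at h1
  rw [ae_withDensity_iff (M.continuous_det k).abs.measurable.ennreal_ofReal] at h1
  filter_upwards [h1, ae_restrict_mem ((M.shape k).measurableSet_carrier _)] with x hx hmem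
  refine hx ?_
  simpa using (M.det_pos k x hmem).ne'

theorem cell_subset_domain (k : K) : M.cell k ⊆ M.domain := Set.subset_iUnion _ k

/-- The derivative of the inverse is `J⁻¹`; scaled by `det J` it becomes the adjugate. Interior
points are required, since outside the cell `pull` takes arbitrary values. -/
theorem fderiv_pull (k : K) {x : Fin (m + 1) → ℝ}
    (hx : x ∈ interior ((M.shape k).carrier (m + 1))) (j : Fin (m + 1)) :
    DifferentiableAt ℝ (M.pull k) (M.map k x) ∧
      (jacobian (M.map k) x).det • fderiv ℝ (M.pull k) (M.map k x) (Pi.single j 1) =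
        fun i => (jacobian (M.map k) x).adjugate i j := by
  have hdet : 0 < (jacobian (M.map k) x).det := M.det_pos k x (interior_subset hx)
  have hdet' : (fderiv ℝ (M.map k) x).det ≠ 0 := by rw [det_fderiv_map]; exact hdet.ne'
  set e := (fderiv ℝ (M.map k) x).toContinuousLinearEquivOfDetNeZero hdet' with he
  have hstrict : HasStrictFDerivAt (M.map k) (e : (Fin (m + 1) → ℝ) →L[ℝ] (Fin (m + 1) → ℝ)) x := by
    rw [he, ContinuousLinearMap.coe_toContinuousLinearEquivOfDetNeZero]
    exact ((M.smooth k).contDiffAt (x := x)).hasStrictFDerivAt two_ne_zero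
  have hcell : M.cell k ∈ nhds (M.map k x) := by
    rw [← hstrict.map_nhds_eq_of_equiv]
    exact Filter.image_mem_map (mem_interior_iff_mem_nhds.1 hx)
  have hpx : M.pull k (M.map k x) = x := M.pull_map k (interior_subset hx)
  have hfd : HasFDerivAt (M.pull k) (e.symm : (Fin (m + 1) → ℝ) →L[ℝ] (Fin (m + 1) → ℝ))
      (M.map k x) := by
    refine HasFDerivAt.of_local_left_inverse ((M.continuousOn_pull k).continuousAt hcell)
      (f := M.map k) ?_ ?_
    · rw [hpx]; exact hstrict.hasFDerivAt
    · filter_upwards [hcell] with y hy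
      exact Function.invFunOn_eq hy
  refine ⟨hfd.differentiableAt, ?_⟩
  rw [hfd.fderiv]
  set y := e.symm (Pi.single j 1) with hy
  have h1 : jacobian (M.map k) x *ᵥ y = Pi.single j 1 := by
    rw [jacobian_mulVec, ← ContinuousLinearMap.toContinuousLinearEquivOfDetNeZero_apply _ hdet',
      ← he, hy, ContinuousLinearEquiv.apply_symm_apply]
  have h2 := congrArg (fun v => (jacobian (M.map k) x).adjugate *ᵥ v) h1
  simp only [Matrix.mulVec_mulVec, Matrix.adjugate_mul, Matrix.smul_mulVec, Matrix.one_mulVec,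
    Matrix.mulVec_single_one] at h2
  exact h2

variable {t : RefCell → DegreeKind} {r : ℕ}

theorem val_map (u : M.DGSpace t r) (k : K) {x : Fin (m + 1) → ℝ}
    (hx : x ∈ (M.shape k).carrier (m + 1)) :
    M.val u k (M.map k x) = MvPolynomial.eval x (u k : MvPolynomial (Fin (m + 1)) ℝ) := by
  have := M.pull_map k hx
  rw [pull] at this
  rw [val, this]

theorem det_mul_fderiv_val (u : M.DGSpace t r) (k : K) {x : Fin (m + 1) → ℝ}
    (hx : x ∈ interior ((M.shape k).carrier (m + 1))) (j : Fin (m + 1)) :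
    (jacobian (M.map k) x).det * fderiv ℝ (M.val u k) (M.map k x) (Pi.single j 1) =
      ∑ i, MvPolynomial.eval x (MvPolynomial.pderiv i (u k : MvPolynomial (Fin (m + 1)) ℝ)) *
        (jacobian (M.map k) x).adjugate i j := by
  obtain ⟨hd, h⟩ := M.fderiv_pull k hx j
  have hpx : M.pull k (M.map k x) = x := M.pull_map k (interior_subset hx)
  have h1 : HasFDerivAt (M.val u k) _ (M.map k x) :=
    (hasFDerivAt_eval (u k : MvPolynomial (Fin (m + 1)) ℝ) (M.pull k (M.map k x))).comp
      (M.map k x) hd.hasFDerivAt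
  rw [h1.fderiv, hpx]
  simp only [ContinuousLinearMap.comp_apply, sum_apply,
    smul_apply, ContinuousLinearMap.proj_apply, smul_eq_mul, Finset.mul_sum]
  refine Finset.sum_congr rfl fun i _ => ?_
  rw [← congrFun h i, Pi.smul_apply, smul_eq_mul]
  ring

theorem massForm_eq [Fintype K] (σ : (Fin (m + 1) → ℝ) → ℝ) (u v : M.DGSpace t r) :
    M.massForm σ u v = ∑ k, ∫ x in (M.shape k).carrier (m + 1),
      ((jacobian (M.map k) x).det * σ (M.map k x)) *
        (MvPolynomial.eval x (u k : MvPolynomial (Fin (m + 1)) ℝ) *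
          MvPolynomial.eval x (v k : MvPolynomial (Fin (m + 1)) ℝ)) := by
  refine Finset.sum_congr rfl fun k _ => ?_
  rw [setIntegral_cell]
  refine setIntegral_congr_fun ((M.shape k).measurableSet_carrier _) fun x hx => ?_
  simp only [M.val_map _ k hx]
  ring

/-- The determinant from the change of variables cancels the one in `J⁻¹`. The integrand is then
polynomials times cofactors, continuous up to the boundary. -/
theorem gradForm_eq [Fintype K] (j : Fin (m + 1)) (u v : M.DGSpace t r) :
    M.gradForm j u v = ∑ k, ∫ x in (M.shape k).carrier (m + 1),
      (∑ i, MvPolynomial.eval x (MvPolynomial.pderiv i (u k : MvPolynomial (Fin (m + 1)) ℝ)) *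
        (jacobian (M.map k) x).adjugate i j) *
          MvPolynomial.eval x (v k : MvPolynomial (Fin (m + 1)) ℝ) := by
  refine Finset.sum_congr rfl fun k _ => ?_
  -- The derivative of `val` is under control only in the interior of the cell; the boundary of the
  -- reference cell is a null set.
  rw [setIntegral_cell, ← setIntegral_congr_set ((M.shape k).interior_carrier_ae_eq _),
    ← setIntegral_congr_set ((M.shape k).interior_carrier_ae_eq _)]
  refine setIntegral_congr_fun isOpen_interior.measurableSet fun x hx => ?_
  simp only [M.val_map _ k (interior_subset hx)]
  rw [← M.det_mul_fderiv_val u k hx j]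
  ring

end CurvedMesh

/-! ### Face integrals and the divergence theorem on the mesh. -/

namespace CurvedMesh

variable {m : ℕ} {K I B : Type} (M : CurvedMesh m K I B)

/-- The jump across a face of a family of functions on the reference cells. -/
noncomputable def faceJump (W : K → (Fin (m + 1) → ℝ) → ℝ) : I ⊕ B → (Fin m → ℝ) → ℝ
  | .inl i, s => W (M.left i).1 (M.pull (M.left i).1 (M.point (.inl i) s))
      - W (M.right i).1 (M.pull (M.right i).1 (M.point (.inl i) s))
  | .inr f, s => W (M.bdry f).1 (M.pull (M.bdry f).1 (M.point (.inr f) s))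

theorem measurableSet_faceDom (Γ : I ⊕ B) : MeasurableSet (M.faceDom Γ) :=
  (M.shape (M.side Γ).1).measurableSet_carrier _

theorem isCompact_faceDom (Γ : I ⊕ B) : IsCompact (M.faceDom Γ) :=
  (M.shape (M.side Γ).1).isCompact_carrier _

theorem det_pos_faceParam (Φ : (k : K) × (M.shape k).Face m) {s : Fin m → ℝ}
    (hs : s ∈ (M.shape Φ.1).carrier m) :
    0 < (jacobian (M.map Φ.1) ((M.shape Φ.1).faceParam Φ.2 s)).det :=
  M.det_pos _ _ ((M.shape Φ.1).faceParam_mem_carrier Φ.2 hs)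

theorem areaDensity_side_pos (Γ : I ⊕ B) {s : Fin m → ℝ} (hs : s ∈ M.faceDom Γ) :
    0 < areaDensity (M.map (M.side Γ).1) _ (M.side Γ).2 s :=
  areaDensity_pos (M.det_pos_faceParam (M.side Γ) hs).ne'

theorem continuous_point (Γ : I ⊕ B) : Continuous (M.point Γ) :=
  (M.smooth _).continuous.comp ((M.shape (M.side Γ).1).continuous_faceParam _)

theorem continuousOn_normal (Γ : I ⊕ B) : ContinuousOn (M.normal Γ) (M.faceDom Γ) :=
  continuousOn_unitNormal (M.smooth _) fun x hx => M.det_pos _ x hx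

theorem curvedFace_mem_cell (Φ : (k : K) × (M.shape k).Face m) {s : Fin m → ℝ}
    (hs : s ∈ (M.shape Φ.1).carrier m) : curvedFace (M.map Φ.1) _ Φ.2 s ∈ M.cell Φ.1 :=
  Set.mem_image_of_mem _ ((M.shape Φ.1).faceParam_mem_carrier Φ.2 hs)

theorem pull_curvedFace (Φ : (k : K) × (M.shape k).Face m) {s : Fin m → ℝ}
    (hs : s ∈ (M.shape Φ.1).carrier m) :
    M.pull Φ.1 (curvedFace (M.map Φ.1) _ Φ.2 s) = (M.shape Φ.1).faceParam Φ.2 s :=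
  M.pull_map _ ((M.shape Φ.1).faceParam_mem_carrier Φ.2 hs)

theorem point_mem_cell_side (Γ : I ⊕ B) {s : Fin m → ℝ} (hs : s ∈ M.faceDom Γ) :
    M.point Γ s ∈ M.cell (M.side Γ).1 :=
  M.curvedFace_mem_cell (M.side Γ) hs

theorem point_mem_cell_right (i : I) {s : Fin m → ℝ} (hs : s ∈ M.faceDom (.inl i)) :
    M.point (.inl i) s ∈ M.cell (M.right i).1 := by
  obtain ⟨π, hbij, -, h⟩ := M.glue i
  have := M.curvedFace_mem_cell (M.right i) (hbij.mapsTo hs)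
  rwa [(h s hs).1] at this

theorem continuousOn_pull_point_side (Γ : I ⊕ B) :
    ContinuousOn (fun s => M.pull (M.side Γ).1 (M.point Γ s)) (M.faceDom Γ) :=
  (M.continuousOn_pull _).comp (M.continuous_point Γ).continuousOn
    fun _ hs => M.point_mem_cell_side Γ hs

theorem continuousOn_pull_point_right (i : I) :
    ContinuousOn (fun s => M.pull (M.right i).1 (M.point (.inl i) s)) (M.faceDom (.inl i)) :=
  (M.continuousOn_pull _).comp (M.continuous_point (.inl i)).continuousOn
    fun _ hs => M.point_mem_cell_right i hs

theorem continuousOn_faceJump {W : K → (Fin (m + 1) → ℝ) → ℝ} (hW : ∀ k, Continuous (W k))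
    (Γ : I ⊕ B) : ContinuousOn (M.faceJump W Γ) (M.faceDom Γ) := by
  cases Γ with
  | inl i =>
    exact ((hW _).comp_continuousOn (M.continuousOn_pull_point_side (.inl i))).sub
      ((hW _).comp_continuousOn (M.continuousOn_pull_point_right i))
  | inr f => exact (hW _).comp_continuousOn (M.continuousOn_pull_point_side (.inr f))

theorem integrableOn_face (Γ : I ⊕ B) {g : (Fin m → ℝ) → ℝ} (hg : ContinuousOn g (M.faceDom Γ)) :
    IntegrableOn (fun s => g s * areaDensity (M.map (M.side Γ).1) _ (M.side Γ).2 s)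
      (M.faceDom Γ) :=
  (hg.mul (continuous_areaDensity (M.smooth _)).continuousOn).integrableOn_compact
    (M.isCompact_faceDom Γ)

theorem areaVector_side (Γ : I ⊕ B) {s : Fin m → ℝ} (hs : s ∈ M.faceDom Γ) (j : Fin (m + 1)) :
    areaVector (M.map (M.side Γ).1) _ (M.side Γ).2 s j =
      M.normal Γ s j * areaDensity (M.map (M.side Γ).1) _ (M.side Γ).2 s := by
  have := congrFun (areaDensity_smul_unitNormal (T := M.map (M.side Γ).1) (f := (M.side Γ).2)
    (M.det_pos_faceParam (M.side Γ) hs).ne') j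
  rw [← this, Pi.smul_apply, smul_eq_mul, mul_comm]
  rfl

/-- The boundary integral over a face of a cell of `W nⱼ`. -/
noncomputable def fluxIntegral (W : K → (Fin (m + 1) → ℝ) → ℝ) (j : Fin (m + 1))
    (Φ : (k : K) × (M.shape k).Face m) : ℝ :=
  ∫ s in (M.shape Φ.1).carrier m,
    W Φ.1 ((M.shape Φ.1).faceParam Φ.2 s) * areaVector (M.map Φ.1) _ Φ.2 s j

theorem fluxIntegral_side (W : K → (Fin (m + 1) → ℝ) → ℝ) (j : Fin (m + 1)) (Γ : I ⊕ B) :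
    M.fluxIntegral W j (M.side Γ) =
      M.faceIntegral Γ fun s => M.normal Γ s j *
        W (M.side Γ).1 (M.pull (M.side Γ).1 (M.point Γ s)) := by
  refine setIntegral_congr_fun (M.measurableSet_faceDom Γ) fun s hs => ?_
  simp only [M.areaVector_side Γ hs, point, M.pull_curvedFace (M.side Γ) hs]
  ring

/-- Change of variables along the gluing map: its Jacobian converts the surface density of the right
side into that of the left, and the opposite unit normals give the minus sign. -/
theorem fluxIntegral_right (hm : m + 1 ≤ 3) (W : K → (Fin (m + 1) → ℝ) → ℝ) (j : Fin (m + 1))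
    (i : I) :
    M.fluxIntegral W j (M.right i) =
      -M.faceIntegral (.inl i) fun s => M.normal (.inl i) s j *
        W (M.right i).1 (M.pull (M.right i).1 (M.point (.inl i) s)) := by
  obtain ⟨π, hbij, hπ, h⟩ := M.glue i
  have hcov := integral_image_eq_integral_abs_det_fderiv_smul volume
    ((M.shape (M.left i).1).measurableSet_carrier m)
    (fun s hs => (hπ s hs).hasFDerivWithinAt) hbij.injOn
    (fun s => W (M.right i).1 ((M.shape (M.right i).1).faceParam (M.right i).2 s) *
      areaVector (M.map (M.right i).1) _ (M.right i).2 s j)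
  rw [hbij.image_eq] at hcov
  rw [fluxIntegral, hcov, faceIntegral, ← integral_neg]
  refine setIntegral_congr_fun (M.measurableSet_faceDom (.inl i)) fun s hs => ?_
  have hmem := hbij.mapsTo hs
  have hd := (M.det_pos_faceParam (M.left i) hs).ne'
  have hd' := (M.det_pos_faceParam (M.right i) hmem).ne'
  have hdens := areaDensity_eq_of_eqOn hm (M.smooth (M.left i).1) (M.smooth (M.right i).1) hπ
    (fun s hs => (h s hs).1) hs hd hd'
  have hpt : M.point (.inl i) s = curvedFace (M.map (M.right i).1) _ (M.right i).2 (π s) :=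
    (h s hs).1.symm
  have hvec := congrFun (areaDensity_smul_unitNormal hd') j
  rw [(h s hs).2] at hvec
  simp only [hpt, M.pull_curvedFace (M.right i) hmem, smul_eq_mul]
  rw [← hvec]
  simp only [Pi.smul_apply, Pi.neg_apply, smul_eq_mul, normal, side]
  rw [hdens]
  ring

/-- The divergence theorem on a curved mesh. -/
theorem sum_setIntegral_fderiv_mul_adjugate [Fintype K] [Fintype I] [Fintype B] (hm : m + 1 ≤ 3)
    {W : K → (Fin (m + 1) → ℝ) → ℝ} (hW : ∀ k, ContDiff ℝ 1 (W k)) (j : Fin (m + 1)) :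
    ∑ k, ∫ x in (M.shape k).carrier (m + 1),
        ∑ i, fderiv ℝ (W k) x (Pi.single i 1) * (jacobian (M.map k) x).adjugate i j =
      ∑ Γ, M.faceIntegral Γ fun s => M.normal Γ s j * M.faceJump W Γ s := by
  have h1 : ∑ k, ∫ x in (M.shape k).carrier (m + 1),
        ∑ i, fderiv ℝ (W k) x (Pi.single i 1) * (jacobian (M.map k) x).adjugate i j =
      ∑ Φ, M.fluxIntegral W j Φ := by
    rw [Fintype.sum_sigma]
    exact Finset.sum_congr rfl fun k _ =>
      setIntegral_fderiv_mul_adjugate hm (M.shape k) (M.smooth k) (hW k) j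
  have hn : ∀ Γ, ContinuousOn (fun s => M.normal Γ s j) (M.faceDom Γ) := fun Γ =>
    continuousOn_pi.1 (M.continuousOn_normal Γ) j
  -- Every face of every cell is met once, so the sum over cell faces regroups into left sides,
  -- right sides and boundary faces.
  rw [h1, ← M.faces_bijective.sum_comp, Fintype.sum_sum_type, Fintype.sum_sum_type,
    Fintype.sum_sum_type, ← Finset.sum_add_distrib]
  simp only [Sum.elim_inl, Sum.elim_inr]
  congr 1
  · refine Finset.sum_congr rfl fun i _ => ?_
    rw [M.fluxIntegral_right hm]
    change M.fluxIntegral W j (M.side (.inl i)) + _ = _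
    rw [M.fluxIntegral_side, ← sub_eq_add_neg, faceIntegral, faceIntegral, faceIntegral,
      ← integral_sub]
    · congr 1
      ext s
      simp only [faceJump, side]
      ring
    · exact M.integrableOn_face (.inl i) ((hn (.inl i)).mul
        ((hW _).continuous.comp_continuousOn (M.continuousOn_pull_point_side (.inl i))))
    · exact M.integrableOn_face (.inl i) ((hn (.inl i)).mul
        ((hW _).continuous.comp_continuousOn (M.continuousOn_pull_point_right i)))
  · exact Finset.sum_congr rfl fun f _ => M.fluxIntegral_side W j (.inr f)

end CurvedMesh

/-! ### Bilinear forms and their matrices. -/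

section Bilinear

variable {V : Type} [AddCommGroup V] [Module ℝ V]

/-- A real function of two vectors is bilinear. -/
structure IsBilin (a : V → V → ℝ) : Prop where
  add_left : ∀ u u' v, a (u + u') v = a u v + a u' v
  smul_left : ∀ (c : ℝ) u v, a (c • u) v = c * a u v
  add_right : ∀ u v v', a u (v + v') = a u v + a u v'
  smul_right : ∀ (c : ℝ) u v, a u (c • v) = c * a u v

namespace IsBilin

theorem mul {φ ψ : V → ℝ} (hφ : IsLinearMap ℝ φ) (hψ : IsLinearMap ℝ ψ) (c : ℝ) :
    IsBilin fun u v => c * (φ u * ψ v) where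
  add_left u u' v := by rw [hφ.map_add]; ring
  smul_left a u v := by rw [hφ.map_smul, smul_eq_mul]; ring
  add_right u v v' := by rw [hψ.map_add]; ring
  smul_right a u v := by rw [hψ.map_smul, smul_eq_mul]; ring

theorem integral {X : Type} [MeasurableSpace X] {μ : Measure X} {f : X → V → V → ℝ}
    (hf : ∀ x, IsBilin (f x)) (hi : ∀ u v, Integrable (fun x => f x u v) μ) :
    IsBilin fun u v => ∫ x, f x u v ∂μ where
  add_left u u' v := by
    simp only [(hf _).add_left]
    exact integral_add (hi u v) (hi u' v)
  smul_left a u v := by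
    simp only [(hf _).smul_left]
    exact integral_const_mul _ _
  add_right u v v' := by
    simp only [(hf _).add_right]
    exact integral_add (hi u v) (hi u v')
  smul_right a u v := by
    simp only [(hf _).smul_right]
    exact integral_const_mul _ _

theorem sum {κ : Type} [Fintype κ] {a : κ → V → V → ℝ} (ha : ∀ k, IsBilin (a k)) :
    IsBilin fun u v => ∑ k, a k u v where
  add_left u u' v := by simp only [(ha _).add_left, Finset.sum_add_distrib]
  smul_left c u v := by simp only [(ha _).smul_left, Finset.mul_sum]
  add_right u v v' := by simp only [(ha _).add_right, Finset.sum_add_distrib]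
  smul_right c u v := by simp only [(ha _).smul_right, Finset.mul_sum]

theorem add {a a' : V → V → ℝ} (ha : IsBilin a) (ha' : IsBilin a') :
    IsBilin fun u v => a u v + a' u v where
  add_left u u' v := by rw [ha.add_left, ha'.add_left]; ring
  smul_left c u v := by rw [ha.smul_left, ha'.smul_left]; ring
  add_right u v v' := by rw [ha.add_right, ha'.add_right]; ring
  smul_right c u v := by rw [ha.smul_right, ha'.smul_right]; ring

theorem const_mul {a : V → V → ℝ} (ha : IsBilin a) (k : ℝ) : IsBilin fun u v => k * a u v where
  add_left u u' v := by rw [ha.add_left]; ring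
  smul_left c u v := by rw [ha.smul_left]; ring
  add_right u v v' := by rw [ha.add_right]; ring
  smul_right c u v := by rw [ha.smul_right]; ring

theorem dotProduct_formMatrix_mulVec {ι : Type} [Fintype ι] {a : V → V → ℝ} (ha : IsBilin a)
    (b : Module.Basis ι ℝ V) (x y : ι → ℝ) :
    y ⬝ᵥ CurvedMesh.formMatrix b a *ᵥ x = a (∑ j, x j • b j) (∑ i, y i • b i) := by
  set A := LinearMap.mk₂ ℝ a ha.add_left ha.smul_left ha.add_right ha.smul_right with hA
  have h : ∀ u v, a u v = A u v := fun _ _ => rfl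
  simp only [h, map_sum, map_smul, LinearMap.sum_apply, LinearMap.smul_apply,
    dotProduct, Matrix.mulVec, CurvedMesh.formMatrix, Matrix.of_apply, smul_eq_mul, Finset.mul_sum]
  refine Finset.sum_congr rfl fun i _ => Finset.sum_congr rfl fun j _ => ?_
  ring

theorem formMatrix_mulVec_eq_zero {ι : Type} [Fintype ι] [DecidableEq ι] {a : V → V → ℝ}
    (ha : IsBilin a) (b : Module.Basis ι ℝ V) (x : ι → ℝ) (h : ∀ v, a (∑ j, x j • b j) v = 0) :
    CurvedMesh.formMatrix b a *ᵥ x = 0 := by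
  ext i
  rw [← single_one_dotProduct (v := CurvedMesh.formMatrix b a *ᵥ x) i,
    ha.dotProduct_formMatrix_mulVec, h, Pi.zero_apply]

end IsBilin

end Bilinear

/-- Closure under differentiation makes the gradient an admissible test function on affine cells. -/
theorem DegreeKind.pderiv_mem_space (t : DegreeKind) {n r : ℕ} (i : Fin n)
    {p : MvPolynomial (Fin n) ℝ} (hp : p ∈ t.space n r) :
    MvPolynomial.pderiv i p ∈ t.space n r := by
  rw [p.as_sum, map_sum]
  refine Submodule.sum_mem _ fun s hs => ?_
  rw [MvPolynomial.pderiv_monomial]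
  have hle : ∀ j, (s - Finsupp.single i 1 : Fin n →₀ ℕ) j ≤ s j := fun j => by
    rw [Finsupp.tsub_apply]; exact Nat.sub_le _ _
  cases t with
  | total =>
    refine (MvPolynomial.mem_restrictTotalDegree _ _ _).2 ?_
    have h1 := (MvPolynomial.mem_restrictTotalDegree _ _ _).1 hp
    refine (MvPolynomial.totalDegree_monomial_le _ _).trans
      (le_trans ?_ ((MvPolynomial.le_totalDegree hs).trans h1))
    rw [Finsupp.sum_fintype _ _ fun _ => rfl, Finsupp.sum_fintype _ _ fun _ => rfl]
    exact Finset.sum_le_sum fun j _ => hle j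
  | separate =>
    refine (MvPolynomial.mem_restrictDegree _ _ _).2 fun s' hs' j => ?_
    have h1 := (MvPolynomial.mem_restrictDegree _ _ _).1 hp s hs j
    have h2 := MvPolynomial.support_monomial_subset hs'
    rw [Finset.mem_singleton] at h2
    rw [h2]
    exact (hle j).trans h1

/-! ### Bilinearity of the discrete forms and definiteness of the mass form. -/

namespace CurvedMesh

variable {m : ℕ} {K I B : Type} (M : CurvedMesh m K I B) {t : RefCell → DegreeKind} {r : ℕ}

/-- The polynomial of a finite element function on a cell. -/
abbrev poly (u : M.DGSpace t r) (k : K) : MvPolynomial (Fin (m + 1)) ℝ := (u k).1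

theorem isLinearMap_eval (k : K) (x : Fin (m + 1) → ℝ) :
    IsLinearMap ℝ fun u : M.DGSpace t r => MvPolynomial.eval x (M.poly u k) :=
  ⟨fun u v => by simp [poly], fun c u => by simp [poly]⟩

theorem isLinearMap_val (k : K) (x : Fin (m + 1) → ℝ) :
    IsLinearMap ℝ fun u : M.DGSpace t r => M.val u k x :=
  M.isLinearMap_eval k _

theorem isLinearMap_jump (Γ : I ⊕ B) (s : Fin m → ℝ) :
    IsLinearMap ℝ fun u : M.DGSpace t r => M.jump u Γ s := by
  cases Γ with
  | inl i =>
    refine ⟨fun u v => ?_, fun c u => ?_⟩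
    · simp only [jump, (M.isLinearMap_val _ _).map_add]; ring
    · simp only [jump, (M.isLinearMap_val _ _).map_smul, smul_eq_mul]; ring
  | inr f => exact M.isLinearMap_val _ _

theorem isLinearMap_avg (θ : ℝ) (Γ : I ⊕ B) (s : Fin m → ℝ) :
    IsLinearMap ℝ fun u : M.DGSpace t r => M.avg θ u Γ s := by
  cases Γ with
  | inl i =>
    refine ⟨fun u v => ?_, fun c u => ?_⟩
    · simp only [avg, (M.isLinearMap_val _ _).map_add]; ring
    · simp only [avg, (M.isLinearMap_val _ _).map_smul, smul_eq_mul]; ring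
  | inr f =>
    refine ⟨fun u v => ?_, fun c u => ?_⟩
    · simp only [avg, (M.isLinearMap_val _ _).map_add]; ring
    · simp only [avg, (M.isLinearMap_val _ _).map_smul, smul_eq_mul]; ring

theorem continuous_eval_poly (u : M.DGSpace t r) (k : K) :
    Continuous fun x => MvPolynomial.eval x (M.poly u k) :=
  (contDiff_eval _).continuous

theorem continuousOn_val_side (u : M.DGSpace t r) (Γ : I ⊕ B) :
    ContinuousOn (fun s => M.val u (M.side Γ).1 (M.point Γ s)) (M.faceDom Γ) :=
  (M.continuous_eval_poly u _).comp_continuousOn (M.continuousOn_pull_point_side Γ)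

theorem continuousOn_val_right (u : M.DGSpace t r) (i : I) :
    ContinuousOn (fun s => M.val u (M.right i).1 (M.point (.inl i) s)) (M.faceDom (.inl i)) :=
  (M.continuous_eval_poly u _).comp_continuousOn (M.continuousOn_pull_point_right i)

theorem continuousOn_jump (u : M.DGSpace t r) (Γ : I ⊕ B) :
    ContinuousOn (M.jump u Γ) (M.faceDom Γ) := by
  cases Γ with
  | inl i => exact (M.continuousOn_val_side u (.inl i)).sub (M.continuousOn_val_right u i)
  | inr f => exact M.continuousOn_val_side u (.inr f)

theorem continuousOn_avg (θ : ℝ) (u : M.DGSpace t r) (Γ : I ⊕ B) :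
    ContinuousOn (M.avg θ u Γ) (M.faceDom Γ) := by
  cases Γ with
  | inl i =>
    exact ((M.continuousOn_val_side u (.inl i)).add (M.continuousOn_val_right u i)).div_const 2
  | inr f => exact continuousOn_const.mul (M.continuousOn_val_side u (.inr f))

theorem continuousOn_dotProduct_normal (ω : Fin (m + 1) → ℝ) (Γ : I ⊕ B) :
    ContinuousOn (fun s => ω ⬝ᵥ M.normal Γ s) (M.faceDom Γ) :=
  (continuous_const.dotProduct continuous_id).comp_continuousOn (M.continuousOn_normal Γ)

theorem isBilin_faceIntegral (Γ : I ⊕ B) {c : (Fin m → ℝ) → ℝ} (hc : ContinuousOn c (M.faceDom Γ))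
    {φ ψ : M.DGSpace t r → (Fin m → ℝ) → ℝ} (hφ : ∀ s, IsLinearMap ℝ fun u => φ u s)
    (hψ : ∀ s, IsLinearMap ℝ fun u => ψ u s) (hφc : ∀ u, ContinuousOn (φ u) (M.faceDom Γ))
    (hψc : ∀ u, ContinuousOn (ψ u) (M.faceDom Γ)) :
    IsBilin fun u v => M.faceIntegral Γ fun s => c s * φ u s * ψ v s := by
  refine IsBilin.integral (fun s => ?_) fun u v => ?_
  · have := IsBilin.mul (hφ s) (hψ s) (c s * areaDensity (M.map (M.side Γ).1) _ (M.side Γ).2 s)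
    convert this using 3
    ring
  · exact M.integrableOn_face Γ ((hc.mul (hφc u)).mul (hψc v))

variable [Fintype K] [Fintype I] [Fintype B]

theorem isBilin_massForm {σ : (Fin (m + 1) → ℝ) → ℝ} (hσ : IntegrableOn σ M.domain) :
    IsBilin (M.massForm (t := t) (r := r) σ) := by
  rw [show M.massForm (t := t) (r := r) σ = _ from funext fun u => funext fun v =>
    M.massForm_eq σ u v]
  refine IsBilin.sum fun k => IsBilin.integral (fun x => ?_) fun u v => ?_
  · exact IsBilin.mul (M.isLinearMap_eval k x) (M.isLinearMap_eval k x) _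
  · exact (M.integrableOn_carrier_of_cell k
      (hσ.mono_set (M.cell_subset_domain k))).mul_continuousOn
      ((M.continuous_eval_poly u k).mul (M.continuous_eval_poly v k)).continuousOn
      ((M.shape k).isCompact_carrier _)

theorem isBilin_gradForm (j : Fin (m + 1)) : IsBilin (M.gradForm (t := t) (r := r) j) := by
  rw [show M.gradForm (t := t) (r := r) j = _ from funext fun u => funext fun v =>
    M.gradForm_eq j u v]
  refine IsBilin.sum fun k => IsBilin.integral (fun x => ?_) fun u v => ?_
  · have h : IsLinearMap ℝ fun u : M.DGSpace t r =>
        ∑ i, MvPolynomial.eval x (MvPolynomial.pderiv i (M.poly u k)) *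
          (jacobian (M.map k) x).adjugate i j :=
      ⟨fun u v => by simp [poly, add_mul, Finset.sum_add_distrib],
        fun c u => by simp [poly, Finset.mul_sum, mul_assoc]⟩
    simpa only [one_mul] using IsBilin.mul h (M.isLinearMap_eval k x) 1
  · have h : Continuous fun x => ∑ i, MvPolynomial.eval x (MvPolynomial.pderiv i (M.poly u k)) *
        (jacobian (M.map k) x).adjugate i j := continuous_finsetSum _ fun i _ =>
      (contDiff_eval _).continuous.mul (contDiff_adjugate_jacobian (M.smooth k) i j).continuous
    exact (h.mul (M.continuous_eval_poly v k)).continuousOn.integrableOn_compact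
      ((M.shape k).isCompact_carrier _)

theorem isBilin_upwindForm (θ : ℝ) (ω : Fin (m + 1) → ℝ) :
    IsBilin (M.upwindForm (t := t) (r := r) θ ω) := by
  have h1 : IsBilin fun u v : M.DGSpace t r => ∑ Γ, M.faceIntegral Γ fun s =>
      (ω ⬝ᵥ M.normal Γ s) * M.jump u Γ s * M.avg θ v Γ s := .sum fun Γ =>
    M.isBilin_faceIntegral Γ (M.continuousOn_dotProduct_normal ω Γ) (M.isLinearMap_jump Γ)
      (M.isLinearMap_avg θ Γ) (fun u => M.continuousOn_jump u Γ) fun u => M.continuousOn_avg θ u Γ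
  have h2 : IsBilin fun u v : M.DGSpace t r => ∑ Γ, M.faceIntegral Γ fun s =>
      |ω ⬝ᵥ M.normal Γ s| * M.jump u Γ s * M.jump v Γ s := .sum fun Γ =>
    M.isBilin_faceIntegral Γ (M.continuousOn_dotProduct_normal ω Γ).abs (M.isLinearMap_jump Γ)
      (M.isLinearMap_jump Γ) (fun u => M.continuousOn_jump u Γ) fun u => M.continuousOn_jump u Γ
  have h := (h1.const_mul (-1)).add (h2.const_mul (1 / 2))
  simp only [neg_one_mul] at h
  exact h

theorem isBilin_upwindFormTilde (θ : ℝ) (ω : Fin (m + 1) → ℝ) :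
    IsBilin (M.upwindFormTilde (t := t) (r := r) θ ω) := by
  have h1 : IsBilin fun u v : M.DGSpace t r => ∑ Γ, M.faceIntegral Γ fun s =>
      (ω ⬝ᵥ M.normal Γ s) * M.avg θ u Γ s * M.jump v Γ s := .sum fun Γ =>
    M.isBilin_faceIntegral Γ (M.continuousOn_dotProduct_normal ω Γ) (M.isLinearMap_avg θ Γ)
      (M.isLinearMap_jump Γ) (fun u => M.continuousOn_avg θ u Γ) fun u => M.continuousOn_jump u Γ
  have h2 : IsBilin fun u v : M.DGSpace t r => ∑ Γ, M.faceIntegral Γ fun s =>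
      |ω ⬝ᵥ M.normal Γ s| * M.jump u Γ s * M.jump v Γ s := .sum fun Γ =>
    M.isBilin_faceIntegral Γ (M.continuousOn_dotProduct_normal ω Γ).abs (M.isLinearMap_jump Γ)
      (M.isLinearMap_jump Γ) (fun u => M.continuousOn_jump u Γ) fun u => M.continuousOn_jump u Γ
  exact h1.add (h2.const_mul (1 / 2))

theorem massForm_comm (σ : (Fin (m + 1) → ℝ) → ℝ) (u v : M.DGSpace t r) :
    M.massForm σ u v = M.massForm σ v u := by
  rw [massForm_eq, massForm_eq]
  simp only [mul_comm]

theorem massForm_self_nonneg {σ : (Fin (m + 1) → ℝ) → ℝ}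
    (hσ : ∀ᵐ x ∂volume.restrict M.domain, 0 ≤ σ x) (u : M.DGSpace t r) :
    0 ≤ M.massForm σ u u := by
  rw [massForm_eq]
  refine Finset.sum_nonneg fun k _ => setIntegral_nonneg_of_ae_restrict ?_
  filter_upwards [M.ae_carrier_of_ae_cell k
    (ae_restrict_of_ae_restrict_of_subset (M.cell_subset_domain k) hσ),
    ae_restrict_mem ((M.shape k).measurableSet_carrier _)] with x hx hmem
  exact mul_nonneg (mul_nonneg (M.det_pos k x hmem).le hx) (mul_self_nonneg _)

theorem eq_zero_of_poly_ae_eq_zero {u : M.DGSpace t r}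
    (h : ∀ k, ∀ᵐ x ∂volume.restrict ((M.shape k).carrier (m + 1)),
      MvPolynomial.eval x (M.poly u k) = 0) : u = 0 :=
  funext fun k => Subtype.ext (eq_zero_of_ae_eval_eq_zero _ (h k))

theorem eq_zero_of_massForm_self {σ : (Fin (m + 1) → ℝ) → ℝ} (hσi : IntegrableOn σ M.domain)
    (hσ : ∀ᵐ x ∂volume.restrict M.domain, 0 < σ x) {u : M.DGSpace t r}
    (hu : M.massForm σ u u = 0) : u = 0 := by
  rw [massForm_eq] at hu
  have hpos : ∀ k, ∀ᵐ x ∂volume.restrict ((M.shape k).carrier (m + 1)),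
      0 < (jacobian (M.map k) x).det * σ (M.map k x) := fun k => by
    filter_upwards [M.ae_carrier_of_ae_cell k
      (ae_restrict_of_ae_restrict_of_subset (M.cell_subset_domain k) hσ),
      ae_restrict_mem ((M.shape k).measurableSet_carrier _)] with x hx hmem
    exact mul_pos (M.det_pos k x hmem) hx
  have hnn : ∀ k, 0 ≤ᵐ[volume.restrict ((M.shape k).carrier (m + 1))] fun x =>
      ((jacobian (M.map k) x).det * σ (M.map k x)) *
        (MvPolynomial.eval x (M.poly u k) * MvPolynomial.eval x (M.poly u k)) := fun k => by
    filter_upwards [hpos k] with x hx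
    exact mul_nonneg hx.le (mul_self_nonneg _)
  refine M.eq_zero_of_poly_ae_eq_zero fun k => ?_
  have h0 := (Finset.sum_eq_zero_iff_of_nonneg fun k _ =>
    setIntegral_nonneg_of_ae_restrict (hnn k)).1 hu k (Finset.mem_univ k)
  have h1 := (setIntegral_eq_zero_iff_of_nonneg_ae (hnn k)
    ((M.integrableOn_carrier_of_cell k
      (hσi.mono_set (M.cell_subset_domain k))).mul_continuousOn
      ((M.continuous_eval_poly u k).mul (M.continuous_eval_poly u k)).continuousOn
      ((M.shape k).isCompact_carrier _))).1 h0
  filter_upwards [h1, hpos k] with x hx hx'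
  exact mul_self_eq_zero.1 ((mul_eq_zero.1 hx).resolve_left hx'.ne')

end CurvedMesh

/-! ### Functions without jumps: vanishing face terms, integration by parts, uniqueness on affine
meshes. -/

namespace CurvedMesh

variable {m : ℕ} {K I B : Type} (M : CurvedMesh m K I B) {t : RefCell → DegreeKind} {r : ℕ}

theorem faceIntegral_sum {δ : Type} [Fintype δ] (Γ : I ⊕ B) (c : δ → ℝ)
    {g : δ → (Fin m → ℝ) → ℝ} (hg : ∀ d, ContinuousOn (g d) (M.faceDom Γ)) :
    ∑ d, c d * M.faceIntegral Γ (g d) = M.faceIntegral Γ fun s => ∑ d, c d * g d s := by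
  simp only [faceIntegral, ← integral_const_mul, Finset.sum_mul]
  rw [← integral_finsetSum]
  · simp only [mul_assoc]
  · exact fun d _ => (M.integrableOn_face Γ (hg d)).const_mul (c d)

theorem faceIntegral_congr_ae (Γ : I ⊕ B) {g h : (Fin m → ℝ) → ℝ}
    (hgh : ∀ᵐ s ∂volume.restrict (M.faceDom Γ), g s = h s) :
    M.faceIntegral Γ g = M.faceIntegral Γ h :=
  integral_congr_ae (hgh.mono fun s hs => by simp only [hs])

theorem faceIntegral_eq_zero_of_ae (Γ : I ⊕ B) {g : (Fin m → ℝ) → ℝ}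
    (hg : ∀ᵐ s ∂volume.restrict (M.faceDom Γ), g s = 0) : M.faceIntegral Γ g = 0 :=
  integral_eq_zero_of_ae (hg.mono fun s hs => by simp only [hs, zero_mul, Pi.zero_apply])

theorem continuousOn_alpha {δ : Type} [Fintype δ] (Q : AngularQuadrature δ) (hm : m + 1 ≤ 3)
    (Γ : I ⊕ B) : ContinuousOn (M.alpha Q hm Γ) (M.faceDom Γ) :=
  continuousOn_const.mul (continuousOn_finsetSum _ fun _ _ =>
    continuousOn_const.mul (M.continuousOn_dotProduct_normal _ Γ).abs)

/-- A finite element function that is continuous and vanishes on the boundary. -/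
def JumpFree (u : M.DGSpace t r) : Prop :=
  ∀ Γ, ∀ᵐ s ∂volume.restrict (M.faceDom Γ), M.jump u Γ s = 0

variable {M}

/-- Every term of `upwindForm` contains the jump of its first argument; in `upwindFormTilde` it is
the jump of the second. -/
theorem JumpFree.upwindForm_eq_zero [Fintype I] [Fintype B] {u : M.DGSpace t r}
    (hu : M.JumpFree u) (θ : ℝ) (ω : Fin (m + 1) → ℝ) (v : M.DGSpace t r) :
    M.upwindForm θ ω u v = 0 := by
  rw [upwindForm, Finset.sum_eq_zero, Finset.sum_eq_zero, neg_zero, mul_zero, add_zero]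
  · exact fun Γ _ => M.faceIntegral_eq_zero_of_ae Γ ((hu Γ).mono fun s hs => by simp [hs])
  · exact fun Γ _ => M.faceIntegral_eq_zero_of_ae Γ ((hu Γ).mono fun s hs => by simp [hs])

theorem JumpFree.upwindFormTilde_eq_zero [Fintype I] [Fintype B] {v : M.DGSpace t r}
    (hv : M.JumpFree v) (θ : ℝ) (ω : Fin (m + 1) → ℝ) (u : M.DGSpace t r) :
    M.upwindFormTilde θ ω u v = 0 := by
  rw [upwindFormTilde, Finset.sum_eq_zero, Finset.sum_eq_zero, mul_zero, add_zero]
  · exact fun Γ _ => M.faceIntegral_eq_zero_of_ae Γ ((hv Γ).mono fun s hs => by simp [hs])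
  · exact fun Γ _ => M.faceIntegral_eq_zero_of_ae Γ ((hv Γ).mono fun s hs => by simp [hs])

/-- Integration by parts. -/
theorem gradForm_add_gradForm [Fintype K] [Fintype I] [Fintype B] (hm : m + 1 ≤ 3)
    (j : Fin (m + 1)) (u v : M.DGSpace t r) :
    M.gradForm j u v + M.gradForm j v u = ∑ Γ, M.faceIntegral Γ fun s => M.normal Γ s j *
      M.faceJump (fun k x => MvPolynomial.eval x (M.poly u k) * MvPolynomial.eval x (M.poly v k))
        Γ s := by
  rw [← M.sum_setIntegral_fderiv_mul_adjugate hm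
    (fun k => (contDiff_eval (M.poly u k)).mul (contDiff_eval (M.poly v k))) j,
    gradForm_eq, gradForm_eq, ← Finset.sum_add_distrib]
  refine Finset.sum_congr rfl fun k _ => ?_
  have hint : ∀ u v : M.DGSpace t r, IntegrableOn (fun x =>
      (∑ i, MvPolynomial.eval x (MvPolynomial.pderiv i (M.poly u k)) *
        (jacobian (M.map k) x).adjugate i j) * MvPolynomial.eval x (M.poly v k))
      ((M.shape k).carrier (m + 1)) := fun u v => by
    have h : Continuous fun x => ∑ i, MvPolynomial.eval x (MvPolynomial.pderiv i (M.poly u k)) *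
        (jacobian (M.map k) x).adjugate i j := continuous_finsetSum _ fun i _ =>
      (contDiff_eval _).continuous.mul (contDiff_adjugate_jacobian (M.smooth k) i j).continuous
    exact (h.mul (M.continuous_eval_poly v k)).continuousOn.integrableOn_compact
      ((M.shape k).isCompact_carrier _)
  rw [← integral_add (hint u v) (hint v u)]
  congr 1
  ext x
  rw [Finset.sum_mul, Finset.sum_mul, ← Finset.sum_add_distrib]
  refine Finset.sum_congr rfl fun i _ => ?_
  rw [fderiv_fun_mul ((contDiff_eval _).differentiable one_ne_zero x)
    ((contDiff_eval _).differentiable one_ne_zero x)]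
  simp only [add_apply, smul_apply, smul_eq_mul, fderiv_eval_single]
  ring

/-- If `⟦v⟧ = 0`, then `⟦uv⟧ = ⟦u⟧ {v}`, so the face terms from integration by parts are exactly
those of the upwind form. On the boundary `v = 0`, so the value of `θ` is immaterial. -/
theorem JumpFree.streaming_add [Fintype K] [Fintype I] [Fintype B] (hm : m + 1 ≤ 3)
    {v : M.DGSpace t r} (hv : M.JumpFree v) (θ : ℝ) (ω : Fin (m + 1) → ℝ) (u : M.DGSpace t r) :
    ∑ j, ω j * M.gradForm j u v + M.upwindForm θ ω u v = -∑ j, ω j * M.gradForm j v u := by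
  have h1 : ∑ j, ω j * M.gradForm j u v + ∑ j, ω j * M.gradForm j v u =
      ∑ Γ, M.faceIntegral Γ fun s => (ω ⬝ᵥ M.normal Γ s) * M.faceJump (fun k x =>
        MvPolynomial.eval x (M.poly u k) * MvPolynomial.eval x (M.poly v k)) Γ s := by
    rw [← Finset.sum_add_distrib]
    simp only [← mul_add, gradForm_add_gradForm hm, Finset.mul_sum]
    rw [Finset.sum_comm]
    refine Finset.sum_congr rfl fun Γ _ => ?_
    rw [faceIntegral_sum]
    · simp only [dotProduct, Finset.sum_mul, mul_assoc]
    · exact fun j => (continuousOn_pi.1 (M.continuousOn_normal Γ) j).mul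
        (M.continuousOn_faceJump (fun k =>
          (M.continuous_eval_poly u k).mul (M.continuous_eval_poly v k)) Γ)
  have h2 : M.upwindForm θ ω u v = -∑ Γ, M.faceIntegral Γ fun s => (ω ⬝ᵥ M.normal Γ s) *
      M.faceJump (fun k x =>
        MvPolynomial.eval x (M.poly u k) * MvPolynomial.eval x (M.poly v k)) Γ s := by
    rw [upwindForm, Finset.sum_eq_zero (s := Finset.univ)
      (f := fun Γ => M.faceIntegral Γ fun s => |ω ⬝ᵥ M.normal Γ s| * M.jump u Γ s * M.jump v Γ s),
      mul_zero, add_zero]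
    · congr 1
      refine Finset.sum_congr rfl fun Γ _ => M.faceIntegral_congr_ae Γ ?_
      filter_upwards [hv Γ] with s hs
      rw [mul_assoc]
      congr 1
      cases Γ with
      | inl i =>
        simp only [jump, sub_eq_zero] at hs
        simp only [jump, avg, faceJump]
        change _ = M.val u _ _ * M.val v _ _ - M.val u _ _ * M.val v _ _
        rw [hs]
        ring
      | inr f =>
        simp only [jump] at hs
        simp only [jump, avg, faceJump]
        change _ = M.val u _ _ * M.val v _ _
        rw [hs]
        ring
    · exact fun Γ _ => M.faceIntegral_eq_zero_of_ae Γ ((hv Γ).mono fun s hs => by simp [hs])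
  rw [h2, ← h1]
  ring

/-- On an affine mesh, a continuous function that vanishes on the boundary and whose weak gradient
is zero vanishes. -/
theorem JumpFree.eq_zero_of_isAffine [Fintype K] [Fintype I] [Fintype B] (hm : m + 1 ≤ 3)
    (hM : M.IsAffine) {u : M.DGSpace t r} (hu : M.JumpFree u)
    (hG : ∀ j (v : M.DGSpace t r), M.gradForm j u v = 0) : u = 0 := by
  have hconst : ∀ k, ∃ A : Matrix (Fin (m + 1)) (Fin (m + 1)) ℝ,
      ∀ x ∈ interior ((M.shape k).carrier (m + 1)), jacobian (M.map k) x = A := fun k => by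
    obtain ⟨A, hA⟩ := hM k
    refine ⟨LinearMap.toMatrix' A.linear, fun x hx => ?_⟩
    have h1 : M.map k =ᶠ[nhds x] fun y => LinearMap.toContinuousLinearMap A.linear y + A 0 := by
      filter_upwards [mem_interior_iff_mem_nhds.1 hx] with y hy
      rw [hA hy, A.decomp]
      simp
    rw [jacobian, h1.fderiv_eq, ((ContinuousLinearMap.hasFDerivAt _).add_const _).fderiv]
    rfl
  choose A hA using hconst
  have hdet : ∀ k, (A k).det ≠ 0 := fun k => by
    obtain ⟨x, hx⟩ := (M.shape k).interior_carrier_nonempty (m + 1)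
    rw [← hA k x hx]
    exact (M.det_pos k x (interior_subset hx)).ne'
  have hq : ∀ k j, ∑ i, (A k).adjugate i j • MvPolynomial.pderiv i (M.poly u k) = 0 := by
    intro k j
    -- With constant Jacobian this is `det A` times the `j`-th physical derivative of `u`, a finite
    -- element function. Testing with it turns the weak gradient condition into vanishing integrals
    -- of squares.
    set v : M.DGSpace t r := fun k =>
      ⟨∑ i, (A k).adjugate i j • MvPolynomial.pderiv i (M.poly u k),
        Submodule.sum_mem _ fun i _ => Submodule.smul_mem _ _
          ((t (M.shape k)).pderiv_mem_space i (u k).2)⟩ with hv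
    have h1 := hG j v
    rw [gradForm_eq] at h1
    have h2 : ∀ k, ∫ x in (M.shape k).carrier (m + 1),
        (∑ i, MvPolynomial.eval x (MvPolynomial.pderiv i (M.poly u k)) *
          (jacobian (M.map k) x).adjugate i j) * MvPolynomial.eval x (M.poly v k) =
        ∫ x in (M.shape k).carrier (m + 1),
          MvPolynomial.eval x (M.poly v k) * MvPolynomial.eval x (M.poly v k) := fun k => by
      rw [← setIntegral_congr_set ((M.shape k).interior_carrier_ae_eq _),
        ← setIntegral_congr_set ((M.shape k).interior_carrier_ae_eq _)]
      refine setIntegral_congr_fun isOpen_interior.measurableSet fun x hx => ?_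
      simp only [hA k x hx]
      congr 1
      simp only [hv, poly, map_sum, MvPolynomial.smul_eval]
      exact Finset.sum_congr rfl fun i _ => mul_comm _ _
    simp only [h2] at h1
    have h3 := (Finset.sum_eq_zero_iff_of_nonneg fun k _ =>
      setIntegral_nonneg ((M.shape k).measurableSet_carrier _) fun x _ =>
        mul_self_nonneg _).1 h1 k (Finset.mem_univ k)
    have h4 := (setIntegral_eq_zero_iff_of_nonneg_ae
      (Filter.Eventually.of_forall fun x => mul_self_nonneg _)
      (((M.continuous_eval_poly v k).mul
        (M.continuous_eval_poly v k)).continuousOn.integrableOn_compact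
        ((M.shape k).isCompact_carrier _))).1 h3
    exact eq_zero_of_ae_eval_eq_zero (M.shape k) (p := M.poly v k)
      (h4.mono fun x hx => mul_self_eq_zero.1 hx)
  have hp : ∀ k i, MvPolynomial.pderiv i (M.poly u k) = 0 := fun k i => by
    -- Multiplication by `A` undoes the adjugate up to `det A` and recovers the reference
    -- derivatives from the physical ones.
    have h1 : ∑ j, (A k) j i • ∑ l, (A k).adjugate l j • MvPolynomial.pderiv l (M.poly u k) =
        (A k).det • MvPolynomial.pderiv i (M.poly u k) := by
      simp only [Finset.smul_sum, smul_smul]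
      rw [Finset.sum_comm]
      simp only [← Finset.sum_smul]
      have h2 : ∀ l, ∑ j, A k j i * (A k).adjugate l j = if l = i then (A k).det else 0 := fun l => by
        have := congrFun (congrFun (Matrix.adjugate_mul (A k)) l) i
        rw [Matrix.mul_apply, Matrix.smul_apply, Matrix.one_apply] at this
        simpa [mul_comm] using this
      simp [h2]
    simp only [hq, smul_zero, Finset.sum_const_zero] at h1
    exact (smul_eq_zero.1 h1.symm).resolve_left (hdet k)
  have hcoord : ∀ k, ContDiff ℝ 1 fun x => M.map k x 0 := fun k =>
    contDiff_pi.1 ((M.smooth k).of_le (by norm_num)) 0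
  -- As `u` is constant on each cell, the field `u² x₀ e₀` has divergence `u²`, and its face terms
  -- vanish. So `∫ u² = 0` follows at once, with no need to propagate the boundary value from cell
  -- to cell.
  have hdiv := M.sum_setIntegral_fderiv_mul_adjugate hm
    (W := fun k x => MvPolynomial.eval x (M.poly u k) * MvPolynomial.eval x (M.poly u k) *
      M.map k x 0)
    (fun k => ((contDiff_eval (M.poly u k)).mul (contDiff_eval (M.poly u k))).mul (hcoord k)) 0
  rw [Finset.sum_eq_zero (s := (Finset.univ : Finset (I ⊕ B)))] at hdiv
  · have hvol : M.massForm (fun _ => 1) u u = 0 := by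
      rw [massForm_eq, ← hdiv]
      refine Finset.sum_congr rfl fun k _ => ?_
      congr 1
      ext x
      have h1 : ∀ i, fderiv ℝ (fun x => MvPolynomial.eval x (M.poly u k) *
          MvPolynomial.eval x (M.poly u k) * M.map k x 0) x (Pi.single i 1) =
          MvPolynomial.eval x (M.poly u k) * MvPolynomial.eval x (M.poly u k) *
            jacobian (M.map k) x 0 i := fun i => by
        have hd := (contDiff_eval (M.poly u k)).differentiable one_ne_zero x
        have hTd := (hasFDerivAt_pi'.1 (M.hasFDerivAt_map k x) 0)
        rw [fderiv_fun_mul (hd.fun_mul hd) ((hcoord k).differentiable one_ne_zero x), hTd.fderiv,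
          fderiv_fun_mul hd hd]
        simp only [add_apply, smul_apply, smul_eq_mul, fderiv_eval_single, hp, map_zero, mul_zero,
          add_zero, ContinuousLinearMap.comp_apply, ContinuousLinearMap.proj_apply, jacobian_apply]
      simp only [h1]
      have h2 : ∑ i, jacobian (M.map k) x 0 i * (jacobian (M.map k) x).adjugate i 0 =
          (jacobian (M.map k) x).det := by
        rw [← Matrix.mul_apply, Matrix.mul_adjugate]
        simp
      simp only [mul_assoc, ← Finset.mul_sum, h2]
      ring
    refine M.eq_zero_of_massForm_self ?_ (Filter.Eventually.of_forall fun _ => one_pos) hvol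
    refine integrableOn_const ?_
    have : IsCompact M.domain := isCompact_iUnion fun k =>
      ((M.shape k).isCompact_carrier _).image (M.smooth k).continuous
    exact this.measure_lt_top.ne
  · intro Γ _
    refine M.faceIntegral_eq_zero_of_ae Γ ?_
    filter_upwards [hu Γ, ae_restrict_mem (M.measurableSet_faceDom Γ)] with s hs hmem
    cases Γ with
    | inl i =>
      -- The coordinate `x₀` takes the same value from both sides of the face, so `u² x₀` jumps only
      -- where `u` does.
      have e1 : M.map (M.left i).1 (M.pull (M.left i).1 (M.point (.inl i) s)) =
          M.point (.inl i) s := Function.invFunOn_eq (M.point_mem_cell_side (.inl i) hmem)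
      have e2 : M.map (M.right i).1 (M.pull (M.right i).1 (M.point (.inl i) s)) =
          M.point (.inl i) s := Function.invFunOn_eq (M.point_mem_cell_right i hmem)
      simp only [jump, sub_eq_zero] at hs
      simp only [faceJump, e1, e2]
      change _ * (M.val u _ _ * M.val u _ _ * _ - M.val u _ _ * M.val u _ _ * _) = 0
      rw [hs]
      ring
    | inr f =>
      simp only [jump] at hs
      simp only [faceJump]
      change _ * (M.val u _ _ * M.val u _ _ * _) = 0
      rw [hs]
      ring

end CurvedMesh

/-! ### The matrices of the discretization satisfy the hypotheses of the matrix theorem. -/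

namespace Discretization

variable {m : ℕ} {K I B δ ι : Type} [Fintype K] [Fintype I] [Fintype B] [Fintype δ] [Fintype ι]
  [DecidableEq ι] (P : Discretization m K I B δ ι)

/-- The finite element function with given coefficients. -/
noncomputable def field (x : ι → ℝ) : P.mesh.DGSpace P.kind P.degree := ∑ j, x j • P.basis j

theorem field_eq_zero_iff {x : ι → ℝ} : P.field x = 0 ↔ x = 0 := by
  refine ⟨fun h => funext (Fintype.linearIndependent_iff.1 P.basis.linearIndependent x h), ?_⟩
  rintro rfl
  simp [field]

theorem field_surjective (v : P.mesh.DGSpace P.kind P.degree) : ∃ x, P.field x = v :=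
  ⟨P.basis.repr v, P.basis.sum_repr v⟩

theorem posSemidef_formMatrix {a : P.mesh.DGSpace P.kind P.degree →
      P.mesh.DGSpace P.kind P.degree → ℝ} (ha : IsBilin a) (hcomm : ∀ u v, a u v = a v u)
    (hnn : ∀ u, 0 ≤ a u u) : (CurvedMesh.formMatrix P.basis a).PosSemidef := by
  refine .of_dotProduct_mulVec_nonneg ?_ fun x => ?_
  · ext i j
    simp [CurvedMesh.formMatrix, hcomm]
  · rw [star_trivial, ha.dotProduct_formMatrix_mulVec]
    exact hnn _

theorem posDef_formMatrix {a : P.mesh.DGSpace P.kind P.degree →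
      P.mesh.DGSpace P.kind P.degree → ℝ} (ha : IsBilin a) (hcomm : ∀ u v, a u v = a v u)
    (hnn : ∀ u, 0 ≤ a u u) (h0 : ∀ u, a u u = 0 → u = 0) :
    (CurvedMesh.formMatrix P.basis a).PosDef := by
  refine .of_dotProduct_mulVec_pos (P.posSemidef_formMatrix ha hcomm hnn).1 fun x hx => ?_
  rw [star_trivial, ha.dotProduct_formMatrix_mulVec]
  exact lt_of_le_of_ne (hnn _) fun h => hx (P.field_eq_zero_iff.1 (h0 _ h.symm))

theorem posDef_formMatrix_massForm {σ : (Fin (m + 1) → ℝ) → ℝ}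
    (hσi : IntegrableOn σ P.mesh.domain)
    (hσ : ∀ᵐ x ∂volume.restrict P.mesh.domain, 0 < σ x) :
    (CurvedMesh.formMatrix P.basis (P.mesh.massForm σ)).PosDef :=
  P.posDef_formMatrix (P.mesh.isBilin_massForm hσi) (P.mesh.massForm_comm σ)
    (P.mesh.massForm_self_nonneg (hσ.mono fun _ h => h.le))
    fun _ hu => P.mesh.eq_zero_of_massForm_self hσi hσ hu

/-- The penalty form `½ ∑_Γ ∫_Γ α ⟦u⟧ ⟦v⟧ dS`. -/
noncomputable def penaltyForm (u v : P.mesh.DGSpace P.kind P.degree) : ℝ :=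
  1 / 2 * ∑ Γ, P.mesh.faceIntegral Γ fun s =>
    P.mesh.alpha P.quad P.dim_le Γ s * P.mesh.jump u Γ s * P.mesh.jump v Γ s

theorem isBilin_penaltyForm : IsBilin P.penaltyForm :=
  (IsBilin.sum fun Γ => P.mesh.isBilin_faceIntegral Γ (P.mesh.continuousOn_alpha _ _ Γ)
    (P.mesh.isLinearMap_jump Γ) (P.mesh.isLinearMap_jump Γ) (fun u => P.mesh.continuousOn_jump u Γ)
    fun u => P.mesh.continuousOn_jump u Γ).const_mul _

/-- The terms linear in `Ω·n` cancel by the vanishing first moment, and `|Ω·n|` averages to `α`. -/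
theorem sum_w_upwindForm (u v : P.mesh.DGSpace P.kind P.degree) :
    1 / (4 * Real.pi) * ∑ d, P.w d * P.mesh.upwindForm P.θ (P.Ω d) u v = P.penaltyForm u v := by
  have h1 : ∀ Γ, ∑ d, P.w d * P.mesh.faceIntegral Γ (fun s =>
      (P.Ω d ⬝ᵥ P.mesh.normal Γ s) * P.mesh.jump u Γ s * P.mesh.avg P.θ v Γ s) = 0 := fun Γ => by
    rw [P.mesh.faceIntegral_sum Γ]
    · refine P.mesh.faceIntegral_eq_zero_of_ae Γ (Filter.Eventually.of_forall fun s => ?_)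
      have h : ∑ d, P.w d * (P.Ω d ⬝ᵥ P.mesh.normal Γ s) = 0 := by
        simp only [dotProduct, Finset.mul_sum, ← mul_assoc]
        rw [Finset.sum_comm]
        simp only [← Finset.sum_mul, P.sum_w_Ω, zero_mul, Finset.sum_const_zero]
      simp only [← mul_assoc, ← Finset.sum_mul, h, zero_mul]
    · exact fun d => ((P.mesh.continuousOn_dotProduct_normal _ Γ).mul
        (P.mesh.continuousOn_jump u Γ)).mul (P.mesh.continuousOn_avg _ v Γ)
  have h2 : ∀ Γ, 1 / (4 * Real.pi) * ∑ d, P.w d * P.mesh.faceIntegral Γ (fun s =>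
      |P.Ω d ⬝ᵥ P.mesh.normal Γ s| * P.mesh.jump u Γ s * P.mesh.jump v Γ s) =
      P.mesh.faceIntegral Γ fun s =>
        P.mesh.alpha P.quad P.dim_le Γ s * P.mesh.jump u Γ s * P.mesh.jump v Γ s := fun Γ => by
    rw [Finset.mul_sum]
    simp only [← mul_assoc (1 / (4 * Real.pi))]
    rw [P.mesh.faceIntegral_sum Γ]
    · congr 1
      ext s
      simp only [CurvedMesh.alpha, Finset.mul_sum, Finset.sum_mul]
      refine Finset.sum_congr rfl fun d _ => ?_
      simp only [w, Ω]
      ring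
    · exact fun d => ((P.mesh.continuousOn_dotProduct_normal _ Γ).abs.mul
        (P.mesh.continuousOn_jump u Γ)).mul (P.mesh.continuousOn_jump v Γ)
  have h3 : ∑ d, P.w d * P.mesh.upwindForm P.θ (P.Ω d) u v =
      1 / 2 * ∑ Γ, ∑ d, P.w d * P.mesh.faceIntegral Γ (fun s =>
        |P.Ω d ⬝ᵥ P.mesh.normal Γ s| * P.mesh.jump u Γ s * P.mesh.jump v Γ s) := by
    simp only [CurvedMesh.upwindForm, mul_add, mul_neg, Finset.sum_add_distrib,
      Finset.sum_neg_distrib]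
    have h4 : ∑ d, P.w d * ∑ Γ, P.mesh.faceIntegral Γ (fun s =>
      (P.Ω d ⬝ᵥ P.mesh.normal Γ s) * P.mesh.jump u Γ s * P.mesh.avg P.θ v Γ s) = 0 := by
      simp only [Finset.mul_sum]
      rw [Finset.sum_comm]
      exact Finset.sum_eq_zero fun Γ _ => h1 Γ
    rw [h4, neg_zero, zero_add, Finset.sum_comm (s := Finset.univ (α := I ⊕ B)), Finset.mul_sum]
    refine Finset.sum_congr rfl fun d _ => ?_
    rw [← Finset.mul_sum]
    ring
  rw [h3, penaltyForm, mul_left_comm, Finset.mul_sum]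
  simp only [h2]

theorem F0_eq : P.F0 = CurvedMesh.formMatrix P.basis P.penaltyForm := by
  ext i j
  simp only [F0, F, CurvedMesh.formMatrix, Matrix.smul_apply, Matrix.sum_apply, Matrix.of_apply,
    smul_eq_mul, ← sum_w_upwindForm]

theorem stream_eq (d : δ) : P.stream d = CurvedMesh.formMatrix P.basis fun u v =>
    ∑ j, P.Ω d j * P.mesh.gradForm j u v := by
  ext i j
  simp only [stream, G, CurvedMesh.formMatrix, Matrix.smul_apply, Matrix.sum_apply,
    Matrix.of_apply, smul_eq_mul]

theorem isBilin_streamForm (d : δ) : IsBilin fun u v : P.mesh.DGSpace P.kind P.degree =>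
    ∑ j, P.Ω d j * P.mesh.gradForm j u v :=
  .sum fun j => (P.mesh.isBilin_gradForm j).const_mul _

variable {P}

section Penalty

variable {α₀ : ℝ} (hα₀ : 0 < α₀)
  (hα : ∀ Γ, ∀ s ∈ P.mesh.faceDom Γ, α₀ ≤ P.mesh.alpha P.quad P.dim_le Γ s)

include hα₀ hα

theorem penaltyForm_integrand_nonneg (u : P.mesh.DGSpace P.kind P.degree) (Γ : I ⊕ B) :
    ∀ s ∈ P.mesh.faceDom Γ, 0 ≤ P.mesh.alpha P.quad P.dim_le Γ s * P.mesh.jump u Γ s *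
      P.mesh.jump u Γ s * areaDensity (P.mesh.map (P.mesh.side Γ).1) _ (P.mesh.side Γ).2 s :=
  fun s hs => by
    rw [mul_assoc (P.mesh.alpha P.quad P.dim_le Γ s)]
    exact mul_nonneg (mul_nonneg (hα₀.le.trans (hα Γ s hs)) (mul_self_nonneg _))
      (P.mesh.areaDensity_side_pos Γ hs).le

theorem penaltyForm_self_nonneg (u : P.mesh.DGSpace P.kind P.degree) : 0 ≤ P.penaltyForm u u :=
  mul_nonneg (by norm_num) <| Finset.sum_nonneg fun Γ _ =>
    setIntegral_nonneg (P.mesh.measurableSet_faceDom Γ) (penaltyForm_integrand_nonneg hα₀ hα u Γ)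

/-- A nonnegative integrand with zero integral vanishes almost everywhere; the positive lower bound
on `α` and the positive surface density leave only the squared jump. -/
theorem jumpFree_of_penaltyForm_self {u : P.mesh.DGSpace P.kind P.degree}
    (hu : P.penaltyForm u u = 0) : P.mesh.JumpFree u := by
  intro Γ
  have h0 := (mul_eq_zero.1 hu).resolve_left (by norm_num)
  have h1 := (Finset.sum_eq_zero_iff_of_nonneg fun Γ _ =>
    setIntegral_nonneg (P.mesh.measurableSet_faceDom Γ)
      (penaltyForm_integrand_nonneg hα₀ hα u Γ)).1 h0 Γ (Finset.mem_univ Γ)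
  have h2 := (setIntegral_eq_zero_iff_of_nonneg_ae
    ((ae_restrict_mem (P.mesh.measurableSet_faceDom Γ)).mono
      (penaltyForm_integrand_nonneg hα₀ hα u Γ))
    (P.mesh.integrableOn_face Γ (((P.mesh.continuousOn_alpha _ _ Γ).mul
      (P.mesh.continuousOn_jump u Γ)).mul (P.mesh.continuousOn_jump u Γ)))).1 h1
  filter_upwards [h2, ae_restrict_mem (P.mesh.measurableSet_faceDom Γ)] with s hs hmem
  have h3 := (mul_eq_zero.1 hs).resolve_right (P.mesh.areaDensity_side_pos Γ hmem).ne'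
  rw [mul_assoc] at h3
  exact mul_self_eq_zero.1 ((mul_eq_zero.1 h3).resolve_left (hα₀.trans_le (hα Γ s hmem)).ne')

theorem posSemidef_F0 : P.F0.PosSemidef := by
  rw [F0_eq]
  refine P.posSemidef_formMatrix P.isBilin_penaltyForm (fun u v => ?_)
    (penaltyForm_self_nonneg hα₀ hα)
  simp only [penaltyForm, mul_assoc, mul_comm (P.mesh.jump u _ _)]

theorem jumpFree_field {x : ι → ℝ} (hx : P.F0 *ᵥ x = 0) : P.mesh.JumpFree (P.field x) := by
  refine jumpFree_of_penaltyForm_self hα₀ hα ?_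
  rw [field, ← P.isBilin_penaltyForm.dotProduct_formMatrix_mulVec, ← F0_eq, hx, dotProduct_zero]

end Penalty

theorem conforming_of_jumpFree {x : ι → ℝ} (hx : P.mesh.JumpFree (P.field x)) :
    P.Conforming x where
  F_mulVec d := (P.mesh.isBilin_upwindForm P.θ (P.Ω d)).formMatrix_mulVec_eq_zero _ _
    fun v => hx.upwindForm_eq_zero _ _ v
  vecMul_Ft d := by
    ext i
    rw [← dotProduct_single_one (v := x ᵥ* P.Ft d) i, ← Matrix.dotProduct_mulVec, Ft,
      (P.mesh.isBilin_upwindFormTilde P.θ (P.Ω d)).dotProduct_formMatrix_mulVec]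
    exact hx.upwindFormTilde_eq_zero _ _ _
  vecMul_stream d := by
    ext i
    -- The `i`-th component of the vector identity is integration by parts against the `i`-th basis
    -- function.
    have h := hx.streaming_add P.dim_le P.θ (P.Ω d) (P.field (Pi.single i 1))
    rw [Pi.neg_apply, ← dotProduct_single_one (v := x ᵥ* (P.stream d + P.F d)) i,
      ← dotProduct_single_one (v := x ᵥ* (P.stream d)ᵀ) i, Matrix.vecMul_transpose,
      ← Matrix.dotProduct_mulVec, Matrix.add_mulVec, dotProduct_add,
      dotProduct_comm (P.stream d *ᵥ x), stream_eq,
      (P.isBilin_streamForm d).dotProduct_formMatrix_mulVec,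
      (P.isBilin_streamForm d).dotProduct_formMatrix_mulVec, F,
      (P.mesh.isBilin_upwindForm P.θ (P.Ω d)).dotProduct_formMatrix_mulVec]
    exact h

end Discretization

end DGTransport

/-! ### The main theorem. -/

open DGTransport in
theorem theorem1 {m : ℕ} {K I B δ ι : Type} [Fintype K] [Fintype I] [Fintype B] [Fintype δ]
    [Fintype ι] [DecidableEq ι] (P : Discretization m K I B δ ι)
    (hσt_int : MeasureTheory.IntegrableOn P.σt P.mesh.domain)
    (hσt_pos : ∀ᵐ x ∂(MeasureTheory.volume.restrict P.mesh.domain), 0 < P.σt x)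
    (hσa_int : MeasureTheory.IntegrableOn P.σa P.mesh.domain)
    (hσa_nonneg : ∀ᵐ x ∂(MeasureTheory.volume.restrict P.mesh.domain), 0 ≤ P.σa x)
    (hα : ∃ α₀ : ℝ, 0 < α₀ ∧
      ∀ Γ, ∀ s ∈ P.mesh.faceDom Γ, α₀ ≤ P.mesh.alpha P.quad P.dim_le Γ s)
    (hD : (∀ᵐ x ∂(MeasureTheory.volume.restrict P.mesh.domain), 0 < P.σa x) ∨
      P.mesh.IsAffine ∨ ∃ ε : ℝ, 0 < ε ∧ IsUnit (P.D ε)) :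
    IsUnit P.Mt ∧
    ∃ C ε₀ : ℝ, 0 < ε₀ ∧ ∀ ε : ℝ, 0 < ε → ε < ε₀ →
      (∀ d, IsUnit (P.sweep ε d)) ∧
      IsUnit (P.D ε) ∧
      ∀ i j, |((ε ^ 2 • P.D ε)⁻¹ * P.Mt * (1 - P.S ε) - 1) i j| ≤ C * ε := by
  obtain ⟨α₀, hα₀, hα⟩ := hα
  have hM : P.Mt.PosDef := P.posDef_formMatrix_massForm hσt_int hσt_pos
  have hMa : P.Ma.PosSemidef := P.posSemidef_formMatrix (P.mesh.isBilin_massForm hσa_int)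
    (P.mesh.massForm_comm _) (P.mesh.massForm_self_nonneg hσa_nonneg)
  have hconf : ∀ x, P.F0 *ᵥ x = 0 → P.Conforming x := fun x hx =>
    Discretization.conforming_of_jumpFree (Discretization.jumpFree_field hα₀ hα hx)
  refine ⟨hM.isUnit, Discretization.theorem_of_matrix_hypotheses hM hMa
    (Discretization.posSemidef_F0 hα₀ hα) hconf fun x hx hG hMx => ?_⟩
  -- On curved cells `G_j x = 0` says only that the gradient is orthogonal to the finite element
  -- space. This is why one of three extra assumptions is used to conclude `x = 0`.
  rcases hD with hσa | hA | ⟨ε, -, hε⟩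
  · have hMa' : P.Ma.PosDef := P.posDef_formMatrix_massForm hσa_int hσa
    exact Matrix.mulVec_injective_iff_isUnit.2 hMa'.isUnit (by rw [hMx, Matrix.mulVec_zero])
  · refine P.field_eq_zero_iff.1 ((Discretization.jumpFree_field hα₀ hα hx).eq_zero_of_isAffine
      P.dim_le hA fun j v => ?_)
    obtain ⟨y, rfl⟩ := P.field_surjective v
    rw [Discretization.field, Discretization.field,
      ← (P.mesh.isBilin_gradForm j).dotProduct_formMatrix_mulVec]
    exact (congrArg (y ⬝ᵥ ·) (hG j)).trans (dotProduct_zero y)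
  · exact (hconf x hx).eq_zero_of_isUnit_D hx hG hMx hε
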